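/- Let $m\ge 3$ and let $\alpha=(\alpha_1,\dots,\alpha_m)$ be a vector of positive real numbers that is generic, i.e. $\sum_{i=1}^m \pm\alpha_i\neq 0$ for all choices of signs, and such that $\alpha_1\le\alpha_2\le\dots\le\alpha_{m-1}$ and $\alpha_m<\sum_{i=1}^{m-1}\alpha_i$. (For $m\le 2$ nothing satisfies all the assumptions made here.) A set $J\subseteq[m]=\{1,\dots,m\}$ is called short if $\sum_{i\in J}\alpha_i<\sum_{i\notin J}\alpha_i$. Let $S_m(\alpha)$ be the collection of all short $J\subseteq[m]$ with $m\in J$, ordered by: $I\le J$ if $I=\{i_1,\dots,i_t\}$ and there are distinct $j_1,\dots,j_t\in J$ with $i_s\le j_s$ for all $s$. The short code of $\alpha$ is the set $\langle A_1,\dots,A_k\rangle$ of maximal elements of $S_m(\alpha)$. Assume that the short code of $\alpha$ is not $\langle\{1,\dots,m-2,m\}\rangle$ (equivalently, $\alpha_i<\sum_{j\ne i}\alpha_j$ for every $i$). Let $$P(\alpha)=\Big\{w\in\prod_{i=1}^{m-1}[-\alpha_i,\alpha_i]\ :\ \sum_{i=1}^{m-1}w_i=\alpha_m\Big\}\subset\mathbb{R}^{m-1}$$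 be the moment polytope. A convex polytope of dimension $d$ is simple if each of its vertices lies on exactly $d$ facets, and a flagtope is a simple polytope in which every collection of pairwise intersecting facets has a nonempty intersection. Then $P(\alpha)$ is a flagtope if and only if the short code of $\alpha$ is one of the following (where $1,\dots,k$ is the empty list if $k\le 0$): 1. $\langle\{1,\dots,m-3,m\}\rangle$, 2. $\langle\{1,\dots,m-4,m-2,m\}\rangle$, 3. $\langle\{1,\dots,m-4,m-1,m\}\rangle$. Moreover, $P(\alpha)$ is combinatorially isomorphic (i.e. has isomorphic face poset) to the cube $I^{m-2}$ in case 1, to $P_5\times I^{m-4}$ with $P_5$ a pentagon in case 2, and to $P_6\times I^{m-4}$ with $P_6$ a hexagon in case 3. (Cases 2 and 3 can occur only for $m\ge4$.) -/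

import Mathlib

namespace ChainPolytope

/-! ### Convex polytopes: faces, facets, simplicity, flagness, combinatorial type -/

section Polytopes

variable {E : Type*} [AddCommGroup E] [Module ℝ E] [TopologicalSpace E]

/-- A convex polytope: the convex hull of finitely many points. -/
def IsPolytope (P : Set E) : Prop :=
  ∃ V : Set E, V.Finite ∧ P = convexHull ℝ V

/-- The dimension of a nonempty convex set: the dimension of its affine hull. -/
noncomputable def dimension (P : Set E) : ℕ :=
  Module.finrank ℝ (vectorSpan ℝ P)

/-- The faces of `P`: the empty set and the sets of maximizers over `P` of a linear functional
(the zero functional gives `P` itself). Being a subtype of `Set E`, it is ordered by inclusion,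
so it is the face poset of `P`. -/
def Face (P : Set E) : Type _ :=
  {F : Set E // IsExposed ℝ P F}

instance (P : Set E) : PartialOrder (Face P) :=
  inferInstanceAs (PartialOrder {F : Set E // IsExposed ℝ P F})

/-- A facet: a (nonempty) face of codimension one. -/
def IsFacet (P F : Set E) : Prop :=
  IsExposed ℝ P F ∧ F.Nonempty ∧ dimension F + 1 = dimension P

/-- The vertices of `P`: the points `v` such that `{v}` is a face. -/
def vertices (P : Set E) : Set E :=
  {v | IsExposed ℝ P {v}}

/-- A polytope of dimension `n` is simple if each vertex lies on exactly `n` facets. -/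
def IsSimple (P : Set E) : Prop :=
  IsPolytope P ∧ ∀ v ∈ vertices P, {F : Set E | IsFacet P F ∧ v ∈ F}.encard = dimension P

/-- A flagtope: a simple polytope such that every collection of pairwise intersecting facets
has a nonempty intersection. -/
def IsFlagtope (P : Set E) : Prop :=
  IsSimple P ∧
    ∀ C : Set (Set E), (∀ F ∈ C, IsFacet P F) →
      (∀ F ∈ C, ∀ G ∈ C, (F ∩ G).Nonempty) → (⋂₀ C).Nonempty

/-- A `k`-gon: a two-dimensional polytope with exactly `k` vertices. -/
def IsPolygon (k : ℕ) (Q : Set E) : Prop :=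
  IsPolytope Q ∧ dimension Q = 2 ∧ (vertices Q).encard = k

/-- Combinatorial isomorphism of polytopes: an isomorphism of the face posets. -/
def CombIso {E' : Type*} [AddCommGroup E'] [Module ℝ E'] [TopologicalSpace E']
    (P : Set E) (Q : Set E') : Prop :=
  Nonempty (Face P ≃o Face Q)

/-- The `k`-dimensional cube `[0,1]^k`. -/
def cube (k : ℕ) : Set (Fin k → ℝ) :=
  {x | ∀ i, x i ∈ Set.Icc (0 : ℝ) 1}

end Polytopes

/-! ### Length vectors and short codes

A length vector with `m = n + 1` entries `α₁, …, α_m` is a function `α : Fin (n + 1) → ℝ`; the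
index `i : Fin (n + 1)` stands for the element `label i = i + 1` of `[m] = {1, …, m}`. -/

/-- The element of `{1, …, n + 1}` that an index stands for. -/
def label {n : ℕ} (i : Fin (n + 1)) : ℕ := (i : ℕ) + 1

/-- No signed sum `± α₁ ± ⋯ ± α_m` vanishes. -/
def IsGeneric {n : ℕ} (α : Fin (n + 1) → ℝ) : Prop :=
  ∀ ε : Fin (n + 1) → ℝ, (∀ i, ε i = 1 ∨ ε i = -1) → ∑ i, ε i * α i ≠ 0

/-- The generic length vectors of (nonempty) chain spaces: positive and generic,
`α₁ ≤ ⋯ ≤ α_{m-1}`, and `α_m < α₁ + ⋯ + α_{m-1}`. -/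
structure IsChainVector {n : ℕ} (α : Fin (n + 1) → ℝ) : Prop where
  pos : ∀ i, 0 < α i
  generic : IsGeneric α
  mono : Monotone fun i : Fin n => α i.castSucc
  last_lt : α (Fin.last n) < ∑ i : Fin n, α i.castSucc

/-- `J` is `α`-short. -/
def IsShort {n : ℕ} (α : Fin (n + 1) → ℝ) (J : Finset (Fin (n + 1))) : Prop :=
  ∑ i ∈ J, α i < ∑ i ∈ Jᶜ, α i

/-- The collection `S_m(α)` of the `α`-short subsets of `[m]` that contain `m`. -/
def shortSubsets {n : ℕ} (α : Fin (n + 1) → ℝ) : Set (Finset (Fin (n + 1))) :=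
  {J | Fin.last n ∈ J ∧ IsShort α J}

/-- The order on subsets of `[m]`: `I = {i₁, …, i_t} ≤ J` if there are distinct
`j₁, …, j_t` in `J` with `i_s ≤ j_s` for all `s`. -/
def SubsetLE {n : ℕ} (I J : Finset (Fin (n + 1))) : Prop :=
  ∃ f : Fin (n + 1) → Fin (n + 1), Set.InjOn f I ∧ ∀ i ∈ I, f i ∈ J ∧ i ≤ f i

/-- The short code of `α`: the set of maximal elements of `S_m(α)`. -/
def shortCode {n : ℕ} (α : Fin (n + 1) → ℝ) : Set (Finset (Fin (n + 1))) :=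
  {A | A ∈ shortSubsets α ∧ ∀ B ∈ shortSubsets α, SubsetLE A B → B = A}

/-- `{1, …, m-2, m}` with `m = n + 1`. -/
def geneTorus (n : ℕ) : Finset (Fin (n + 1)) :=
  Finset.univ.filter fun i => label i + 2 ≤ n + 1 ∨ label i = n + 1

/-- `{1, …, m-3, m}` with `m = n + 1`. -/
def geneCube (n : ℕ) : Finset (Fin (n + 1)) :=
  Finset.univ.filter fun i => label i + 3 ≤ n + 1 ∨ label i = n + 1

/-- `{1, …, m-4, m-2, m}` with `m = n + 1`. -/
def genePentagon (n : ℕ) : Finset (Fin (n + 1)) :=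
  Finset.univ.filter fun i => label i + 4 ≤ n + 1 ∨ label i + 2 = n + 1 ∨ label i = n + 1

/-- `{1, …, m-4, m-1, m}` with `m = n + 1`. -/
def geneHexagon (n : ℕ) : Finset (Fin (n + 1)) :=
  Finset.univ.filter fun i => label i + 4 ≤ n + 1 ∨ label i + 1 = n + 1 ∨ label i = n + 1

/-- The moment polytope `P(α)`: the points of the box `∏_{i<m} [-α_i, α_i]` in `ℝ^{m-1}` whose
coordinates sum to `α_m`. -/
def momentPolytope {n : ℕ} (α : Fin (n + 1) → ℝ) : Set (Fin n → ℝ) :=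
  {w | (∀ i, w i ∈ Set.Icc (-α i.castSucc) (α i.castSucc)) ∧ ∑ i, w i = α (Fin.last n)}

end ChainPolytope

/-! Put n = m - 1, let β be the first n entries of α, a the last one, and p, q, r the three largest
indices below m in increasing order. Then P(α) is the slice of the box ∏ [-β i, β i] by the
hyperplane of coordinate sum a. Genericity keeps the vertices of the box off the hyperplane, so
every point of the slice has a coordinate strictly inside its interval. A face whose relative
interior has f such free coordinates has dimension f - 1; hence the facets are the nonempty sets w i
= ±β i, and the slice is always simple (`isFacet_boxSlice_iff`, `isSimple_boxSlice`).

The facets w i = -β i for i in K and w i = β i for i in I have a common point iff K and I are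
disjoint, 2 ∑_K β < ∑ β - a and 2 ∑_I β < ∑ β + a (`exists_mem_boxSlice_iff`). Call K, respectively
I, light for the lower, respectively upper, threshold, and heavy otherwise. The slice is a flagtope
iff each family of light sets is determined by its members with at most two elements
(`isFlagtope_boxSlice_iff`). A set is light for one threshold iff its complement is heavy for the
other.

Excluding the code ⟨{1, …, m-2, m}⟩ makes every singleton light for the upper threshold. Flagness
then puts a heavy pair for the upper threshold in the complement of every set that is light for the
lower one. Testing this on ∅, {q} and {r} leaves three systems of inequalities in β p, β q, β r, and
each of them conversely implies flagness (`cubeOrPentagonOrHexagon_of_light`,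
`light_of_cubeOrPentagonOrHexagon`).

A set J containing m is short iff J without m is light for the lower threshold. So each of the three
codes says that one particular set is short and dominates all short sets, which unwinds to the same
systems of inequalities.

For the combinatorial types, polyhedra realizing the same sets of active constraints have isomorphic
face posets (`combIso_polyhedron`). In each case lightness depends only on the last two or three
coordinates, so the others split off as a cube (`combIso_boxSlice_of_split`), leaving a segment, a
pentagon or a hexagon as the model. -/

namespace ChainPolytope

open Filter Topology

set_option linter.unusedSectionVars false

/-! ### Polyhedra and their faces -/

section Polyhedra

variable {E : Type*} [AddCommGroup E] [Module ℝ E] [TopologicalSpace E]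
variable {κ : Type*}

/-- A continuous affine real-valued function. -/
def IsAffineFun (f : E → ℝ) : Prop :=
  ∃ (l : StrongDual ℝ E) (c : ℝ), ∀ x, f x = l x + c

theorem IsAffineFun.const (c : ℝ) : IsAffineFun fun _ : E => c := ⟨0, c, by simp⟩

theorem IsAffineFun.of_dual (l : StrongDual ℝ E) : IsAffineFun fun x : E => l x :=
  ⟨l, 0, by simp⟩

theorem IsAffineFun.add {f g : E → ℝ} (hf : IsAffineFun f) (hg : IsAffineFun g) :
    IsAffineFun fun x => f x + g x := by
  obtain ⟨l, c, h⟩ := hf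
  obtain ⟨l', c', h'⟩ := hg
  refine ⟨l + l', c + c', fun x => ?_⟩
  simp only [h, h', add_apply]
  ring

theorem IsAffineFun.const_mul {f : E → ℝ} (hf : IsAffineFun f) (a : ℝ) :
    IsAffineFun fun x => a * f x := by
  obtain ⟨l, c, h⟩ := hf
  refine ⟨a • l, a * c, fun x => ?_⟩
  simp only [h, smul_apply, smul_eq_mul]
  ring

theorem IsAffineFun.sub {f g : E → ℝ} (hf : IsAffineFun f) (hg : IsAffineFun g) :
    IsAffineFun fun x => f x - g x := by
  simpa [sub_eq_add_neg] using hf.add (hg.const_mul (-1))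

theorem IsAffineFun.apply_add_smul_sub {f : E → ℝ} (hf : IsAffineFun f) (x y : E) (t : ℝ) :
    f (x + t • (x - y)) = f x + t * (f x - f y) := by
  obtain ⟨l, c, h⟩ := hf
  simp only [h, map_add, map_smul, map_sub, smul_eq_mul]
  ring

theorem IsAffineFun.continuous {f : E → ℝ} (hf : IsAffineFun f) : Continuous f := by
  obtain ⟨l, c, h⟩ := hf
  rw [show f = fun x => l x + c from funext h]
  fun_prop

/-- A set that contains the line through any two of its points. -/
def IsFlat (A : Set E) : Prop :=
  ∀ x ∈ A, ∀ y ∈ A, ∀ t : ℝ, x + t • (x - y) ∈ A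

theorem isFlat_univ : IsFlat (Set.univ : Set E) := fun _ _ _ _ _ => trivial

/-- The part of `A` where all the functions `f i` are nonnegative. -/
def polyhedron (A : Set E) (f : κ → E → ℝ) : Set E :=
  {x | x ∈ A ∧ ∀ i, 0 ≤ f i x}

/-- The points of the polyhedron satisfying with equality all the inequalities that hold with
equality at `x₀`. -/
def activeFace (A : Set E) (f : κ → E → ℝ) (x₀ : E) : Set E :=
  {x | x ∈ polyhedron A f ∧ ∀ i, f i x₀ = 0 → f i x = 0}

variable {A : Set E} {f : κ → E → ℝ}

/-- The segment from `x` to `x₀` can be prolonged past `x₀`: constraints active at `x₀` vanish on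
the whole line, and the finitely many others stay positive for small `ε`. Only `x ∈ A` is needed, so
`x` may lie outside the polyhedron. -/
theorem exists_extension [Finite κ] (hA : IsFlat A) (hf : ∀ i, IsAffineFun (f i)) {x₀ x : E}
    (hx₀ : x₀ ∈ polyhedron A f) (hxA : x ∈ A) (hx : ∀ i, f i x₀ = 0 → f i x = 0) :
    ∃ ε > (0 : ℝ), x₀ + ε • (x₀ - x) ∈ polyhedron A f := by
  have key : ∀ i, ∀ᶠ ε : ℝ in 𝓝[>] 0, 0 ≤ f i (x₀ + ε • (x₀ - x)) := by
    intro i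
    simp only [(hf i).apply_add_smul_sub]
    rcases (hx₀.2 i).eq_or_lt with h | h
    · exact Eventually.of_forall fun ε => by simp [← h, hx i h.symm]
    · have hc : Tendsto (fun ε : ℝ => f i x₀ + ε * (f i x₀ - f i x)) (𝓝[>] 0)
          (𝓝 (f i x₀ + 0 * (f i x₀ - f i x))) :=
        (Continuous.tendsto (by fun_prop) 0).mono_left nhdsWithin_le_nhds
      simp only [zero_mul, add_zero] at hc
      exact (hc.eventually (lt_mem_nhds h)).mono fun _ => le_of_lt
  obtain ⟨ε, h, hε⟩ := ((eventually_all.2 key).and self_mem_nhdsWithin).exists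
  exact ⟨ε, hε, hA _ hx₀.1 _ hxA _, h⟩

/-- The exposing functional is minus the linear part of the sum of the constraints active at `x₀`:
that sum is nonnegative on the polyhedron and vanishes exactly on the active face. -/
theorem isExposed_activeFace [Finite κ] (hf : ∀ i, IsAffineFun (f i)) {x₀ : E}
    (hx₀ : x₀ ∈ polyhedron A f) : IsExposed ℝ (polyhedron A f) (activeFace A f x₀) := by
  classical
  intro _
  have := Fintype.ofFinite κ
  choose l c h using hf
  let s : Finset κ := Finset.univ.filter fun i => f i x₀ = 0
  have hsum : ∀ x, ∑ i ∈ s, f i x = ∑ i ∈ s, l i x + ∑ i ∈ s, c i := fun x => by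
    simp only [h, Finset.sum_add_distrib]
  have hzero : ∑ i ∈ s, f i x₀ = 0 := Finset.sum_eq_zero fun i hi => (Finset.mem_filter.1 hi).2
  refine ⟨-∑ i ∈ s, l i, Set.ext fun x => ?_⟩
  have hle : ∀ x y : E, (-∑ i ∈ s, l i) y ≤ (-∑ i ∈ s, l i) x ↔
      ∑ i ∈ s, f i x ≤ ∑ i ∈ s, f i y := fun x y => by
    simp only [hsum, neg_apply, sum_apply]
    constructor <;> intro h <;> linarith
  simp only [Set.mem_ofPred_eq, hle]
  refine ⟨fun hx => ⟨hx.1, fun y hy => ?_⟩, fun hx => ⟨hx.1, fun i hi => ?_⟩⟩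
  · rw [Finset.sum_eq_zero fun i hi => hx.2 i (Finset.mem_filter.1 hi).2]
    exact Finset.sum_nonneg fun i _ => hy.2 i
  · have h0 : ∑ i ∈ s, f i x = 0 :=
      le_antisymm (hzero ▸ hx.2 x₀ hx₀) (Finset.sum_nonneg fun i _ => hx.1.2 i)
    exact (Finset.sum_eq_zero_iff_of_nonneg fun i _ => hx.1.2 i).1 h0 i (by simp [s, hi])

/-- A functional maximal at `x₀` cannot increase when the segment from `x` is prolonged past `x₀`,
so its value at `x` is at least that at `x₀`. -/
theorem exposed_subset_activeFace [Finite κ] (hA : IsFlat A) (hf : ∀ i, IsAffineFun (f i))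
    {F : Set E} (hF : IsExposed ℝ (polyhedron A f) F) {x₀ : E} (hx₀ : x₀ ∈ F) :
    activeFace A f x₀ ⊆ F := by
  obtain ⟨l, rfl⟩ := hF ⟨x₀, hx₀⟩
  intro x hx
  obtain ⟨ε, hε, hm⟩ := exists_extension hA hf hx₀.1 hx.1.1 hx.2
  have := hx₀.2 _ hm
  simp only [map_add, map_smul, map_sub, smul_eq_mul] at this
  have h1 : l x₀ ≤ l x := by nlinarith
  exact ⟨hx.1, fun y hy => (hx₀.2 y hy).trans h1⟩

/-- A point of `F` with the fewest active constraints plays the role of a relative interior point.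
-/
theorem exists_eq_activeFace [Finite κ] (hA : IsFlat A) (hf : ∀ i, IsAffineFun (f i))
    {F : Set E} (hF : IsExposed ℝ (polyhedron A f) F) (hne : F.Nonempty) :
    ∃ x₀ ∈ F, F = activeFace A f x₀ := by
  obtain ⟨x₀, hx₀, hmin⟩ :=
    WellFounded.has_min (measure fun x : E => {i | f i x = 0}.ncard).wf F hne
  refine ⟨x₀, hx₀, Set.Subset.antisymm (fun x hx => ?_) (exposed_subset_activeFace hA hf hF hx₀)⟩
  obtain ⟨l, hl⟩ := hF hne
  have hF' : ∀ y, y ∈ F ↔ y ∈ polyhedron A f ∧ ∀ z ∈ polyhedron A f, l z ≤ l y := by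
    intro y
    rw [hl]
    rfl
  have hxP := ((hF' x).1 hx).1
  have hx₀P := ((hF' x₀).1 hx₀).1
  refine ⟨hxP, fun i hi => ?_⟩
  -- The midpoint of `x₀` and `x`: a constraint is active there iff it is active at both, so
  -- minimality at `x₀` forces those active at `x₀` to be active at `x`.
  set z := x₀ + (-(1 / 2) : ℝ) • (x₀ - x) with hz
  have hfz : ∀ j, f j z = (f j x₀ + f j x) / 2 := fun j => by
    rw [hz, (hf j).apply_add_smul_sub]
    ring
  have hzF : z ∈ F := by
    refine (hF' z).2 ⟨⟨hA _ hx₀P.1 _ hxP.1 _, fun j => ?_⟩, fun y hy => ?_⟩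
    · rw [hfz]
      linarith [hxP.2 j, hx₀P.2 j]
    · have h1 := ((hF' x).1 hx).2 y hy
      have h2 := ((hF' x₀).1 hx₀).2 y hy
      simp only [hz, map_add, map_smul, map_sub, smul_eq_mul]
      linarith
  have hsub : {j | f j z = 0} ⊆ {j | f j x₀ = 0} := fun j hj => by
    have h0 : f j z = 0 := hj
    rw [hfz] at h0
    show f j x₀ = 0
    linarith [hxP.2 j, hx₀P.2 j]
  have hcard : {j | f j x₀ = 0}.ncard ≤ {j | f j z = 0}.ncard := not_lt.1 (hmin z hzF)
  have heq := Set.eq_of_subset_of_ncard_le hsub hcard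
  have hi' : i ∈ {j | f j z = 0} := heq ▸ hi
  have h0 : f i z = 0 := hi'
  rw [hfz] at h0
  linarith [hxP.2 i, hx₀P.2 i]

theorem mem_activeFace_self {x₀ : E} (hx₀ : x₀ ∈ polyhedron A f) : x₀ ∈ activeFace A f x₀ :=
  ⟨hx₀, fun _ h => h⟩

/-! ### Face posets determined by active sets -/

section CombinatorialIsomorphism

variable {E' : Type*} [AddCommGroup E'] [Module ℝ E'] [TopologicalSpace E']
variable {B : Set E'} {g : κ → E' → ℝ}

/-- The points of the polyhedron `(B, g)` with the same active set as some point of `F`. -/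
def transport (B : Set E') (f : κ → E → ℝ) (g : κ → E' → ℝ) (F : Set E) : Set E' :=
  {y | y ∈ polyhedron B g ∧ ∃ x ∈ F, ∀ i, f i x = 0 ↔ g i y = 0}

/-- Write `F` as the active face of `x₀`; its transport is the active face of any point with the
same active set as `x₀`. -/
theorem isExposed_transport [Finite κ] (hA : IsFlat A) (hf : ∀ i, IsAffineFun (f i))
    (hg : ∀ i, IsAffineFun (g i))
    (hPQ : ∀ x ∈ polyhedron A f, ∃ y ∈ polyhedron B g, ∀ i, f i x = 0 ↔ g i y = 0)
    (hQP : ∀ y ∈ polyhedron B g, ∃ x ∈ polyhedron A f, ∀ i, f i x = 0 ↔ g i y = 0)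
    {F : Set E} (hF : IsExposed ℝ (polyhedron A f) F) :
    IsExposed ℝ (polyhedron B g) (transport B f g F) := by
  rcases F.eq_empty_or_nonempty with rfl | hne
  · rintro ⟨y, _, x, hx, _⟩
    exact hx.elim
  obtain ⟨x₀, hx₀, rfl⟩ := exists_eq_activeFace hA hf hF hne
  obtain ⟨y₀, hy₀, h₀⟩ := hPQ x₀ hx₀.1
  have : transport B f g (activeFace A f x₀) = activeFace B g y₀ := by
    ext y
    constructor
    · rintro ⟨hy, x, hx, hxy⟩
      exact ⟨hy, fun i hi => (hxy i).1 (hx.2 i ((h₀ i).2 hi))⟩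
    · rintro ⟨hy, h⟩
      obtain ⟨x, hx, hxy⟩ := hQP y hy
      exact ⟨hy, x, ⟨hx, fun i hi => (hxy i).2 (h i ((h₀ i).1 hi))⟩, hxy⟩
  rw [this]
  exact isExposed_activeFace hg hy₀

theorem transport_transport [Finite κ] (hA : IsFlat A) (hf : ∀ i, IsAffineFun (f i))
    (hPQ : ∀ x ∈ polyhedron A f, ∃ y ∈ polyhedron B g, ∀ i, f i x = 0 ↔ g i y = 0)
    {F : Set E} (hF : IsExposed ℝ (polyhedron A f) F) :
    transport A g f (transport B f g F) = F := by
  ext x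
  constructor
  · rintro ⟨hx, y, ⟨hy, x', hx', h'⟩, h⟩
    exact exposed_subset_activeFace hA hf hF hx'
      ⟨hx, fun i hi => (h i).1 ((h' i).1 hi)⟩
  · intro hx
    have hxP := hF.subset hx
    obtain ⟨y, hy, h⟩ := hPQ x hxP
    exact ⟨hxP, y, ⟨hy, x, hx, h⟩, fun i => (h i).symm⟩

theorem transport_mono {F F' : Set E} (h : F ⊆ F') : transport B f g F ⊆ transport B f g F' :=
  fun _ hy => ⟨hy.1, hy.2.imp fun _ hx => ⟨h hx.1, hx.2⟩⟩

/-- Two polyhedra with the same active sets are combinatorially isomorphic. -/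
theorem combIso_polyhedron [Finite κ] (hA : IsFlat A) (hf : ∀ i, IsAffineFun (f i))
    (hB : IsFlat B) (hg : ∀ i, IsAffineFun (g i))
    (hPQ : ∀ x ∈ polyhedron A f, ∃ y ∈ polyhedron B g, ∀ i, f i x = 0 ↔ g i y = 0)
    (hQP : ∀ y ∈ polyhedron B g, ∃ x ∈ polyhedron A f, ∀ i, f i x = 0 ↔ g i y = 0) :
    CombIso (polyhedron A f) (polyhedron B g) := by
  have hPQ' : ∀ x ∈ polyhedron A f, ∃ y ∈ polyhedron B g, ∀ i, g i y = 0 ↔ f i x = 0 :=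
    fun x hx => (hPQ x hx).imp fun y hy => ⟨hy.1, fun i => (hy.2 i).symm⟩
  have hQP' : ∀ y ∈ polyhedron B g, ∃ x ∈ polyhedron A f, ∀ i, g i y = 0 ↔ f i x = 0 :=
    fun x hx => (hQP x hx).imp fun y hy => ⟨hy.1, fun i => (hy.2 i).symm⟩
  exact ⟨{
    toFun := fun F => ⟨transport B f g F.1, isExposed_transport hA hf hg hPQ hQP F.2⟩
    invFun := fun G => ⟨transport A g f G.1, isExposed_transport hB hg hf hQP' hPQ' G.2⟩
    left_inv := fun F => Subtype.ext (transport_transport hA hf hPQ F.2)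
    right_inv := fun G => Subtype.ext (transport_transport hB hg hQP' G.2)
    map_rel_iff' := by
      intro F F'
      refine ⟨fun h => ?_, fun h => transport_mono (B := B) (f := f) (g := g) h⟩
      have h' : transport A g f (transport B f g F.1) ⊆ transport A g f (transport B f g F'.1) :=
        transport_mono h
      rwa [transport_transport hA hf hPQ F.2, transport_transport hA hf hPQ F'.2] at h' }⟩

end CombinatorialIsomorphism

/-! ### Compact polyhedra are polytopes -/

theorem convex_polyhedron (hA : IsFlat A) (hf : ∀ i, IsAffineFun (f i)) :
    Convex ℝ (polyhedron A f) := by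
  intro x hx y hy a b ha hb hab
  have hz : a • x + b • y = x + (-b) • (x - y) := by
    rw [← eq_sub_iff_add_eq] at hab
    subst hab
    module
  rw [hz]
  refine ⟨hA x hx.1 y hy.1 _, fun i => ?_⟩
  rw [(hf i).apply_add_smul_sub]
  have : f i x + -b * (f i x - f i y) = a * f i x + b * f i y := by
    rw [← eq_sub_iff_add_eq] at hab
    subst hab
    ring
  rw [this]
  exact add_nonneg (mul_nonneg ha (hx.2 i)) (mul_nonneg hb (hy.2 i))

/-- An extreme point is determined by its active set: if `y` has the same one, the segment from `y`
to `x` extends past `x`, which makes `x` interior to a segment starting at `y`. -/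
theorem finite_extremePoints_polyhedron [Finite κ] (hA : IsFlat A)
    (hf : ∀ i, IsAffineFun (f i)) : ((polyhedron A f).extremePoints ℝ).Finite := by
  refine Set.Finite.of_finite_image (f := fun x => {i | f i x = 0}) (Set.toFinite _) ?_
  intro x hx y hy hxy
  have hxy' : ∀ i, f i x = 0 ↔ f i y = 0 := fun i => by
    simpa using Set.ext_iff.1 hxy i
  obtain ⟨ε, hε, hm⟩ := exists_extension hA hf hx.1 hy.1.1 fun i => (hxy' i).1
  refine (((mem_extremePoints.1 hx).2 y hy.1 _ hm ?_).1).symm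
  refine ⟨ε / (1 + ε), 1 / (1 + ε), by positivity, by positivity, by field_simp; ring, ?_⟩
  have h1 : (1 + ε) ≠ 0 := by positivity
  have : (ε / (1 + ε)) • y + (1 / (1 + ε)) • (x + ε • (x - y))
      = ((1 / (1 + ε)) * (1 + ε)) • x := by
    have : ε / (1 + ε) = (1 / (1 + ε)) * ε := by ring
    rw [this]
    module
  rw [this, one_div_mul_cancel h1, one_smul]

end Polyhedra

/-- Krein–Milman, where the closure is superfluous because the hull of finitely many points is
closed. -/
theorem isPolytope_polyhedron {E : Type*} [NormedAddCommGroup E] [NormedSpace ℝ E]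
    [FiniteDimensional ℝ E] {κ : Type*} [Finite κ] {A : Set E} {f : κ → E → ℝ} (hA : IsFlat A)
    (hf : ∀ i, IsAffineFun (f i)) (hc : IsCompact (polyhedron A f)) :
    IsPolytope (polyhedron A f) := by
  have hfin := finite_extremePoints_polyhedron hA hf
  refine ⟨_, hfin, ?_⟩
  rw [← (hfin.isClosed_convexHull ℝ).closure_eq]
  exact (closure_convexHull_extremePoints hc (convex_polyhedron hA hf)).symm
/-! ### Hyperplane sections of a box -/

section BoxSlice

variable {ι : Type*} [Fintype ι] [DecidableEq ι]

/-- The sign attached to the two ends of an interval: `1` for the upper end. -/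
def endSign (b : Bool) : ℝ := if b then 1 else -1

/-- The distance of the coordinate `w d.1` to the end `d.2` of `[-β d.1, β d.1]`. -/
def slack (β : ι → ℝ) (d : ι × Bool) (w : ι → ℝ) : ℝ := β d.1 - endSign d.2 * w d.1

/-- The points of the box `∏ [-β i, β i]` whose coordinates sum to `a`. -/
def boxSlice (β : ι → ℝ) (a : ℝ) : Set (ι → ℝ) :=
  polyhedron {w | ∑ i, w i = a} (slack β)

/-- The points of the slice where the inequality indexed by `d` is an equality. -/
def side (β : ι → ℝ) (a : ℝ) (d : ι × Bool) : Set (ι → ℝ) :=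
  {w | w ∈ boxSlice β a ∧ slack β d w = 0}

/-- The coordinates of `w` lying in the interior of their interval. -/
noncomputable def free (β w : ι → ℝ) : Finset ι :=
  Finset.univ.filter fun i => -β i < w i ∧ w i < β i

variable {β w : ι → ℝ} {a : ℝ}

theorem slack_true (i : ι) : slack β (i, true) w = β i - w i := by simp [slack, endSign]

theorem slack_false (i : ι) : slack β (i, false) w = β i + w i := by simp [slack, endSign]

theorem mem_boxSlice :
    w ∈ boxSlice β a ↔ ∑ i, w i = a ∧ ∀ i, -β i ≤ w i ∧ w i ≤ β i := by
  simp only [boxSlice, polyhedron, Set.mem_ofPred_eq, Prod.forall, Bool.forall_bool, slack_true,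
    slack_false]
  refine and_congr_right fun _ => forall_congr' fun i => ?_
  constructor <;> rintro ⟨h1, h2⟩ <;> constructor <;> linarith

theorem isFlat_sum_eq (a : ℝ) : IsFlat {w : ι → ℝ | ∑ i, w i = a} := by
  intro x (hx : ∑ i, x i = a) y (hy : ∑ i, y i = a) t
  show ∑ i, (x + t • (x - y)) i = a
  simp [Finset.sum_add_distrib, ← Finset.mul_sum, hx, hy]

theorem isAffineFun_apply (i : ι) : IsAffineFun fun w : ι → ℝ => w i :=
  IsAffineFun.of_dual (ContinuousLinearMap.proj (R := ℝ) (φ := fun _ : ι => ℝ) i)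

theorem isAffineFun_slack (d : ι × Bool) : IsAffineFun (slack β d) :=
  (IsAffineFun.const _).sub ((isAffineFun_apply d.1).const_mul _)

theorem isPolytope_boxSlice : IsPolytope (boxSlice β a) := by
  refine isPolytope_polyhedron (isFlat_sum_eq a) isAffineFun_slack ?_
  refine (isCompact_univ_pi fun i => isCompact_Icc (a := -β i) (b := β i)).of_isClosed_subset ?_
    fun w hw i _ => (mem_boxSlice.1 hw).2 i
  have : polyhedron {w | ∑ i, w i = a} (slack β)
      = {w | ∑ i, w i = a} ∩ ⋂ d, {w | 0 ≤ slack β d w} := by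
    ext w
    simp [polyhedron]
  rw [this]
  refine (isClosed_eq (by fun_prop) (by fun_prop)).inter (isClosed_iInter fun d => ?_)
  exact isClosed_le continuous_const (isAffineFun_slack d).continuous

theorem mem_free {i : ι} : i ∈ free β w ↔ -β i < w i ∧ w i < β i := by simp [free]

theorem exists_slack_eq_zero (hw : w ∈ boxSlice β a) {i : ι} (hi : i ∉ free β w) :
    ∃ b, slack β (i, b) w = 0 := by
  have h := (mem_boxSlice.1 hw).2 i
  simp only [mem_free, not_and_or, not_lt] at hi
  rcases hi with hi | hi
  · exact ⟨false, by rw [slack_false]; linarith⟩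
  · exact ⟨true, by rw [slack_true]; linarith⟩

theorem notMem_free_of_slack_eq_zero {d : ι × Bool} (h : slack β d w = 0) :
    d.1 ∉ free β w := by
  obtain ⟨i, _ | _⟩ := d
  · rw [slack_false] at h
    exact fun hi => by linarith [(mem_free.1 hi).1]
  · rw [slack_true] at h
    exact fun hi => by linarith [(mem_free.1 hi).2]

theorem eq_of_slack_eq_zero (hβ : ∀ i, 0 < β i) {i : ι} {b b' : Bool}
    (h : slack β (i, b) w = 0) (h' : slack β (i, b') w = 0) : b = b' := by
  have := hβ i
  cases b <;> cases b' <;> simp only [slack_true, slack_false] at h h' <;> first | rfl | linarith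

/-- A point without free coordinates is a vertex of the box; with K the set of its lower ends, its
coordinate sum is ∑ β - 2 ∑_K β, which differs from `a` by genericity. -/
theorem free_nonempty (hg : ∀ K : Finset ι, 2 * ∑ i ∈ K, β i ≠ ∑ i, β i - a)
    (hw : w ∈ boxSlice β a) : (free β w).Nonempty := by
  by_contra hne
  rw [Finset.not_nonempty_iff_eq_empty] at hne
  refine hg (Finset.univ.filter fun i => w i = -β i) ?_
  have hi : ∀ i, w i = β i - 2 * if w i = -β i then β i else 0 := fun i => by
    obtain ⟨b, hb⟩ := exists_slack_eq_zero hw (i := i) (by simp [hne])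
    split_ifs with h
    · linarith
    · cases b
      · rw [slack_false] at hb
        exact absurd (by linarith) h
      · rw [slack_true] at hb
        linarith
  have hs := (mem_boxSlice.1 hw).1
  rw [Finset.sum_congr rfl fun i _ => hi i, Finset.sum_sub_distrib, ← Finset.mul_sum,
    ← Finset.sum_filter] at hs
  linarith

/-- A point of the slice can be moved, in a set of coordinates containing a free one, so as to
make all of them free. -/
theorem exists_spread (hβ : ∀ i, 0 < β i) (hw : w ∈ boxSlice β a) {S : Finset ι} {k : ι}
    (hk : k ∈ S) (hkf : k ∈ free β w) :
    ∃ w' ∈ boxSlice β a, (∀ i ∉ S, w' i = w i) ∧ ∀ i ∈ S, i ∈ free β w' := by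
  obtain ⟨hs, hb⟩ := mem_boxSlice.1 hw
  have hpos : 0 < ∑ i ∈ S, β i := Finset.sum_pos (fun i _ => hβ i) ⟨k, hk⟩
  have hlt : ∑ i ∈ S, w i < ∑ i ∈ S, β i :=
    Finset.sum_lt_sum (fun i _ => (hb i).2) ⟨k, hk, (mem_free.1 hkf).2⟩
  have hgt : -∑ i ∈ S, β i < ∑ i ∈ S, w i := by
    rw [← Finset.sum_neg_distrib]
    exact Finset.sum_lt_sum (fun i _ => (hb i).1) ⟨k, hk, (mem_free.1 hkf).1⟩
  -- On `S` the new point is `t * β i`, with `t` chosen to preserve the sum; the free coordinate `k`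
  -- makes |t| < 1.
  set t := (∑ i ∈ S, w i) / ∑ i ∈ S, β i with ht
  have ht1 : t < 1 := (div_lt_one hpos).2 hlt
  have ht2 : -1 < t := by rw [ht, lt_div_iff₀ hpos]; linarith
  have htS : t * ∑ i ∈ S, β i = ∑ i ∈ S, w i := div_mul_cancel₀ _ hpos.ne'
  have hfree : ∀ i, -β i < t * β i ∧ t * β i < β i := fun i =>
    ⟨by nlinarith [hβ i], by nlinarith [hβ i]⟩
  refine ⟨fun i => if i ∈ S then t * β i else w i, mem_boxSlice.2 ⟨?_, fun i => ?_⟩,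
    fun i hi => by simp [hi], fun i hi => by simpa [mem_free, hi] using hfree i⟩
  · rw [← hs, ← Finset.sum_add_sum_compl S, ← Finset.sum_add_sum_compl S (fun i => w i), ← htS,
      Finset.mul_sum]
    congr 1
    · exact Finset.sum_congr rfl fun i hi => by simp [hi]
    · exact Finset.sum_congr rfl fun i hi => by simp [Finset.mem_compl.1 hi]
  · by_cases hi : i ∈ S
    · simpa [hi] using ⟨(hfree i).1.le, (hfree i).2.le⟩
    · simpa [hi] using hb i

/-! #### Dimensions of faces -/

/-- The vectors supported on `M` whose coordinates sum to zero. -/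
def supportedKer (M : Finset ι) : Submodule ℝ (ι → ℝ) where
  carrier := {v | (∀ i ∉ M, v i = 0) ∧ ∑ i, v i = 0}
  add_mem' := fun {u v} hu hv => ⟨fun i hi => by simp [hu.1 i hi, hv.1 i hi],
    by simp [Finset.sum_add_distrib, hu.2, hv.2]⟩
  zero_mem' := by simp
  smul_mem' := fun c v hv => ⟨fun i hi => by simp [hv.1 i hi],
    by simp [← Finset.mul_sum, hv.2]⟩

/-- This space is the kernel of the sum functional on `M → ℝ`, which is nonzero because `M` is
nonempty. -/
theorem finrank_supportedKer {M : Finset ι} (hM : M.Nonempty) :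
    Module.finrank ℝ (supportedKer M) + 1 = M.card := by
  let φ : Module.Dual ℝ (M → ℝ) := ∑ i, LinearMap.proj i
  have hφ : ∀ v, φ v = ∑ i, v i := fun v => by simp [φ]
  have hne : φ ≠ 0 := by
    obtain ⟨k, hk⟩ := hM
    intro h
    have := congrArg (fun l => l (Pi.single ⟨k, hk⟩ 1)) h
    simp [hφ] at this
  have hker := Module.Dual.finrank_ker_add_one_of_ne_zero hne
  rw [Module.finrank_fintype_fun_eq_card, Fintype.card_coe] at hker
  rw [← hker]
  congr 1
  refine LinearEquiv.finrank_eq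
    { toFun := fun v => ⟨fun i => v.1 i, ?_⟩
      map_add' := fun _ _ => rfl
      map_smul' := fun _ _ => rfl
      invFun := fun v => ⟨fun i => if h : i ∈ M then v.1 ⟨i, h⟩ else 0, ?_, ?_⟩
      left_inv := ?_
      right_inv := ?_ }
  · rw [LinearMap.mem_ker, hφ, Finset.sum_coe_sort M fun i => v.1 i, ← v.2.2]
    exact Finset.sum_subset (Finset.subset_univ _) fun i _ hi => v.2.1 i hi
  · intro i hi
    simp [hi]
  · have h0 : ∑ i, v.1 i = 0 := by rw [← hφ]; exact v.2
    refine (Finset.sum_subset (Finset.subset_univ M) fun i _ hi => by simp [hi]).symm.trans ?_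
    rw [← Finset.sum_coe_sort]
    exact (Finset.sum_congr rfl fun i _ => by simp).trans h0
  · intro v
    ext i
    by_cases hi : i ∈ M
    · simp [hi]
    · simp [hi, v.2.1 i hi]
  · intro v
    ext i
    simp

theorem eq_of_mem_activeFace {x₀ x : ι → ℝ}
    (hx : x ∈ activeFace {w | ∑ i, w i = a} (slack β) x₀) (hx₀ : x₀ ∈ boxSlice β a) {i : ι}
    (hi : i ∉ free β x₀) : x i = x₀ i := by
  obtain ⟨b, hb⟩ := exists_slack_eq_zero hx₀ hi
  have := hx.2 _ hb
  cases b
  · rw [slack_false] at hb this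
    linarith
  · rw [slack_true] at hb this
    linarith

theorem vectorSpan_activeFace {x₀ : ι → ℝ} (hx₀ : x₀ ∈ boxSlice β a) :
    vectorSpan ℝ (activeFace {w | ∑ i, w i = a} (slack β) x₀) = supportedKer (free β x₀) := by
  refine le_antisymm ?_ fun v hv => ?_
  · rw [vectorSpan, Submodule.span_le]
    rintro _ ⟨x, hx, y, hy, rfl⟩
    refine ⟨fun i hi => ?_, ?_⟩
    · simp [eq_of_mem_activeFace hx hx₀ hi, eq_of_mem_activeFace hy hx₀ hi]
    · have h1 : ∑ i, x i = a := hx.1.1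
      have h2 : ∑ i, y i = a := hy.1.1
      simp [h1, h2]
  · have hact : ∀ d, slack β d x₀ = 0 → slack β d (x₀ - v) = 0 := fun d hd => by
      rw [← hd]
      simp [slack, hv.1 _ (notMem_free_of_slack_eq_zero hd)]
    -- Prolonging the segment from `x₀ - v` past `x₀` gives the point `x₀ + ε • v` of the active
    -- face, so `v` is a direction of that face.
    obtain ⟨ε, hε, hm⟩ := exists_extension (x := x₀ - v) (isFlat_sum_eq a) isAffineFun_slack hx₀
      (by
        have : ∑ i, x₀ i = a := hx₀.1
        show ∑ i, (x₀ - v) i = a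
        simp [this, hv.2]) hact
    have hm' : x₀ + ε • (x₀ - (x₀ - v)) ∈ activeFace {w | ∑ i, w i = a} (slack β) x₀ :=
      ⟨hm, fun d hd => by
        rw [(isAffineFun_slack d).apply_add_smul_sub, hact d hd, hd]
        simp⟩
    have := vsub_mem_vectorSpan ℝ hm' (mem_activeFace_self hx₀)
    simp only [sub_sub_cancel, vsub_eq_sub, add_sub_cancel_left] at this
    exact (Submodule.smul_mem_iff _ hε.ne').1 this

theorem dimension_activeFace {x₀ : ι → ℝ} (hx₀ : x₀ ∈ boxSlice β a)
    (hne : (free β x₀).Nonempty) :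
    dimension (activeFace {w | ∑ i, w i = a} (slack β) x₀) + 1 = (free β x₀).card := by
  rw [dimension, vectorSpan_activeFace hx₀, finrank_supportedKer hne]

theorem dimension_boxSlice (hβ : ∀ i, 0 < β i)
    (hg : ∀ K : Finset ι, 2 * ∑ i ∈ K, β i ≠ ∑ i, β i - a) (hne : (boxSlice β a).Nonempty) :
    dimension (boxSlice β a) + 1 = Fintype.card ι := by
  obtain ⟨x, hx⟩ := hne
  obtain ⟨k, hk⟩ := free_nonempty hg hx
  obtain ⟨x₀, hx₀, -, hfree⟩ := exists_spread hβ hx (Finset.mem_univ k) hk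
  have hf : free β x₀ = Finset.univ := Finset.eq_univ_of_forall fun i => hfree i (Finset.mem_univ i)
  have hP : boxSlice β a = activeFace {w | ∑ i, w i = a} (slack β) x₀ :=
    Set.ext fun y => ⟨fun hy => ⟨hy, fun d hd =>
      absurd (by simp [hf]) (notMem_free_of_slack_eq_zero hd)⟩, fun hy => hy.1⟩
  rw [hP, dimension_activeFace hx₀ (hf ▸ ⟨k, Finset.mem_univ k⟩), hf, Finset.card_univ]

/-! #### Facets and simplicity -/

/-- Some coordinate is free on the side, and it is not `d.1`; spreading over all indices but `d.1`
leaves `d` as the only active constraint. -/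
theorem exists_relInterior_side (hβ : ∀ i, 0 < β i)
    (hg : ∀ K : Finset ι, 2 * ∑ i ∈ K, β i ≠ ∑ i, β i - a) {d : ι × Bool}
    (hne : (side β a d).Nonempty) :
    ∃ x ∈ boxSlice β a, free β x = Finset.univ.erase d.1 ∧ ∀ d', slack β d' x = 0 ↔ d' = d := by
  obtain ⟨w, hw, hd⟩ := hne
  obtain ⟨k, hk⟩ := free_nonempty hg hw
  have hkd : k ≠ d.1 := fun h => notMem_free_of_slack_eq_zero hd (h ▸ hk)
  obtain ⟨x, hx, hoff, hon⟩ := exists_spread hβ hw (S := Finset.univ.erase d.1)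
    (Finset.mem_erase.2 ⟨hkd, Finset.mem_univ k⟩) hk
  have hdx : slack β d x = 0 := by
    rw [← hd, slack, slack, hoff d.1 (by simp)]
  have hfree : free β x = Finset.univ.erase d.1 := by
    refine Finset.Subset.antisymm (fun i hi => ?_) hon
    exact Finset.mem_erase.2 ⟨fun h => notMem_free_of_slack_eq_zero hdx (h ▸ hi),
      Finset.mem_univ i⟩
  refine ⟨x, hx, hfree, fun d' => ⟨fun h => ?_, fun h => h ▸ hdx⟩⟩
  have h1 : d'.1 = d.1 := by
    have := notMem_free_of_slack_eq_zero h
    rw [hfree] at this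
    simpa using this
  obtain ⟨i, b⟩ := d
  obtain ⟨i', b'⟩ := d'
  obtain rfl : i' = i := h1
  rw [eq_of_slack_eq_zero hβ h hdx]

theorem side_eq_activeFace {d : ι × Bool} {x : ι → ℝ} (hd : ∀ d', slack β d' x = 0 ↔ d' = d) :
    side β a d = activeFace {w | ∑ i, w i = a} (slack β) x := by
  ext y
  refine and_congr_right fun _ => ?_
  simp [hd]

/-- By the dimension count, codimension one means that a relative interior point has exactly one
coordinate that is not free. -/
theorem isFacet_boxSlice_iff (hβ : ∀ i, 0 < β i)
    (hg : ∀ K : Finset ι, 2 * ∑ i ∈ K, β i ≠ ∑ i, β i - a) {F : Set (ι → ℝ)} :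
    IsFacet (boxSlice β a) F ↔ ∃ d, (side β a d).Nonempty ∧ F = side β a d := by
  constructor
  · rintro ⟨hF, hne, hdim⟩
    have hP := dimension_boxSlice hβ hg (hne.mono hF.subset)
    obtain ⟨x₀, hx₀, rfl⟩ := exists_eq_activeFace (isFlat_sum_eq a) isAffineFun_slack hF hne
    have hx₀P : x₀ ∈ boxSlice β a := hx₀.1
    have hd := dimension_activeFace hx₀P (free_nonempty hg hx₀P)
    have hcard : (free β x₀)ᶜ.card = 1 := by
      rw [Finset.card_compl]
      omega
    obtain ⟨i, hi⟩ := Finset.card_eq_one.1 hcard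
    have hi' : i ∉ free β x₀ := Finset.mem_compl.1 (hi ▸ Finset.mem_singleton_self i)
    obtain ⟨b, hb⟩ := exists_slack_eq_zero hx₀P hi'
    refine ⟨(i, b), ⟨x₀, hx₀P, hb⟩, (side_eq_activeFace fun d' => ⟨fun h => ?_, ?_⟩).symm⟩
    · have h1 : d'.1 ∈ (free β x₀)ᶜ := Finset.mem_compl.2 (notMem_free_of_slack_eq_zero h)
      rw [hi, Finset.mem_singleton] at h1
      obtain ⟨i', b'⟩ := d'
      obtain rfl : i' = i := h1
      rw [eq_of_slack_eq_zero hβ h hb]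
    · rintro rfl
      exact hb
  · rintro ⟨d, hne, rfl⟩
    obtain ⟨x, hx, hfree, hd⟩ := exists_relInterior_side hβ hg hne
    have hP := dimension_boxSlice hβ hg ⟨x, hx⟩
    have hF := dimension_activeFace hx (free_nonempty hg hx)
    rw [hfree, Finset.card_erase_of_mem (Finset.mem_univ _), Finset.card_univ] at hF
    refine ⟨?_, hne, ?_⟩
    · rw [side_eq_activeFace hd]
      exact isExposed_activeFace isAffineFun_slack hx
    · rw [side_eq_activeFace hd]
      omega

theorem side_injective (hβ : ∀ i, 0 < β i)
    (hg : ∀ K : Finset ι, 2 * ∑ i ∈ K, β i ≠ ∑ i, β i - a) {d d' : ι × Bool}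
    (hne : (side β a d).Nonempty) (h : side β a d = side β a d') : d = d' := by
  obtain ⟨x, hx, -, hd⟩ := exists_relInterior_side hβ hg hne
  have hxd : x ∈ side β a d := ⟨hx, (hd d).2 rfl⟩
  rw [h] at hxd
  exact ((hd d').1 hxd.2).symm

/-- A vertex is a face of dimension zero, so it has one free coordinate. Each other coordinate is at
exactly one end of its interval, and distinct nonempty sides are distinct facets. -/
theorem isSimple_boxSlice (hβ : ∀ i, 0 < β i)
    (hg : ∀ K : Finset ι, 2 * ∑ i ∈ K, β i ≠ ∑ i, β i - a) : IsSimple (boxSlice β a) := by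
  refine ⟨isPolytope_boxSlice, fun v hv => ?_⟩
  have hvP : v ∈ boxSlice β a := IsExposed.subset hv rfl
  have hcard : (free β v).card = 1 := by
    obtain ⟨x, rfl, hx⟩ := exists_eq_activeFace (isFlat_sum_eq a) isAffineFun_slack hv ⟨v, rfl⟩
    rw [← dimension_activeFace hvP (free_nonempty hg hvP), ← hx, dimension,
      vectorSpan_singleton, finrank_bot]
  have hset : {F | IsFacet (boxSlice β a) F ∧ v ∈ F} = side β a '' {d | slack β d v = 0} := by
    ext F
    simp only [isFacet_boxSlice_iff hβ hg, Set.mem_ofPred_eq, Set.mem_image]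
    constructor
    · rintro ⟨⟨d, -, rfl⟩, h⟩
      exact ⟨d, h.2, rfl⟩
    · rintro ⟨d, h, rfl⟩
      exact ⟨⟨d, ⟨v, hvP, h⟩, rfl⟩, hvP, h⟩
  have hinj : Set.InjOn (side β a) {d | slack β d v = 0} := fun d hd d' _ h =>
    side_injective hβ hg ⟨v, hvP, hd⟩ h
  have himg : Prod.fst '' {d : ι × Bool | slack β d v = 0} = ((free β v)ᶜ : Finset ι) := by
    ext i
    simp only [Set.mem_image, Set.mem_ofPred_eq, Prod.exists, exists_and_right, exists_eq_right,
      Finset.coe_compl, Set.mem_compl_iff, Finset.mem_coe]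
    exact ⟨fun ⟨b, hb⟩ => notMem_free_of_slack_eq_zero hb, exists_slack_eq_zero hvP⟩
  have hfst : Set.InjOn Prod.fst {d : ι × Bool | slack β d v = 0} := by
    rintro ⟨i, b⟩ hd ⟨i', b'⟩ hd' h
    obtain rfl : i = i' := h
    rw [eq_of_slack_eq_zero hβ hd hd']
  have hP := dimension_boxSlice hβ hg ⟨v, hvP⟩
  rw [hset, hinj.encard_image, ← hfst.encard_image, himg, Set.encard_coe_eq_coe_finsetCard,
    Finset.card_compl, hcard]
  congr 1
  omega

/-! #### Intersections of facets and flagness -/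

theorem exists_mem_boxSlice_iff (hβ : ∀ i, 0 < β i)
    (hg : ∀ K : Finset ι, 2 * ∑ i ∈ K, β i ≠ ∑ i, β i - a) {K I : Finset ι} :
    (∃ w ∈ boxSlice β a, (∀ i ∈ K, w i = -β i) ∧ ∀ i ∈ I, w i = β i) ↔
      Disjoint K I ∧ 2 * ∑ i ∈ K, β i < ∑ i, β i - a ∧ 2 * ∑ i ∈ I, β i < ∑ i, β i + a := by
  constructor
  · rintro ⟨w, hw, hK, hI⟩
    obtain ⟨hs, hb⟩ := mem_boxSlice.1 hw
    refine ⟨Finset.disjoint_left.2 fun i h1 h2 => ?_, lt_of_le_of_ne ?_ (hg K),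
      lt_of_le_of_ne ?_ ?_⟩
    · linarith [hK i h1, hI i h2, hβ i]
    · have h1 : ∑ i ∈ K, w i = -∑ i ∈ K, β i := by
        rw [← Finset.sum_neg_distrib]
        exact Finset.sum_congr rfl hK
      have h2 : ∑ i ∈ Kᶜ, w i ≤ ∑ i ∈ Kᶜ, β i := Finset.sum_le_sum fun i _ => (hb i).2
      rw [← Finset.sum_add_sum_compl K] at hs
      rw [← Finset.sum_add_sum_compl K β]
      linarith
    · have h1 : ∑ i ∈ I, w i = ∑ i ∈ I, β i := Finset.sum_congr rfl hI
      have h2 : -∑ i ∈ Iᶜ, β i ≤ ∑ i ∈ Iᶜ, w i := by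
        rw [← Finset.sum_neg_distrib]
        exact Finset.sum_le_sum fun i _ => (hb i).1
      rw [← Finset.sum_add_sum_compl I] at hs
      rw [← Finset.sum_add_sum_compl I β]
      linarith
    -- Equality for `I` at the upper threshold would be equality for its complement at the lower
    -- one.
    · have := hg Iᶜ
      have h := Finset.sum_add_sum_compl I β
      contrapose! this
      linarith
  · rintro ⟨hd, hK, hI⟩
    set M := (K ∪ I)ᶜ with hM
    have hsplit : ∀ f : ι → ℝ, ∑ i, f i = ∑ i ∈ K, f i + ∑ i ∈ I, f i + ∑ i ∈ M, f i := fun f => by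
      rw [← Finset.sum_union hd, Finset.sum_add_sum_compl]
    have hβs := hsplit β
    have hpos : 0 < ∑ i ∈ M, β i := by linarith
    -- The coordinates outside `K ∪ I` are set to `t * β i` so that the total is `a`; the bounds t <
    -- 1 and -1 < t are exactly the two lightness inequalities.
    set t := (a + ∑ i ∈ K, β i - ∑ i ∈ I, β i) / ∑ i ∈ M, β i with ht
    have ht1 : t < 1 := by rw [ht, div_lt_one hpos]; linarith
    have ht2 : -1 < t := by rw [ht, lt_div_iff₀ hpos]; linarith
    have htM : t * ∑ i ∈ M, β i = a + ∑ i ∈ K, β i - ∑ i ∈ I, β i := div_mul_cancel₀ _ hpos.ne'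
    refine ⟨fun i => if i ∈ K then -β i else if i ∈ I then β i else t * β i,
      mem_boxSlice.2 ⟨?_, fun i => ?_⟩, fun i hi => by simp [hi], fun i hi => ?_⟩
    · have h1 : ∀ i ∈ I, (if i ∈ K then -β i else if i ∈ I then β i else t * β i) = β i :=
        fun i hi => by simp [hi, Finset.disjoint_right.1 hd hi]
      have h2 : ∀ i ∈ M, (if i ∈ K then -β i else if i ∈ I then β i else t * β i) = t * β i :=
        fun i hi => by
          simp only [hM, Finset.mem_compl, Finset.mem_union, not_or] at hi
          simp [hi.1, hi.2]
      have h3 : ∀ i ∈ K, (if i ∈ K then -β i else if i ∈ I then β i else t * β i) = -β i :=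
        fun i hi => by simp [hi]
      rw [hsplit, Finset.sum_congr rfl h1, Finset.sum_congr rfl h2, Finset.sum_congr rfl h3,
        ← Finset.mul_sum, htM, Finset.sum_neg_distrib]
      ring
    · have := hβ i
      split_ifs
      · constructor <;> linarith
      · constructor <;> linarith
      · constructor <;> nlinarith
    · simp [hi, Finset.disjoint_right.1 hd hi]

theorem mem_side_false {i : ι} :
    w ∈ side β a (i, false) ↔ w ∈ boxSlice β a ∧ w i = -β i := by
  refine and_congr_right fun _ => ?_
  rw [slack_false]
  constructor <;> intro h <;> linarith

theorem mem_side_true {i : ι} :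
    w ∈ side β a (i, true) ↔ w ∈ boxSlice β a ∧ w i = β i := by
  refine and_congr_right fun _ => ?_
  rw [slack_true]
  constructor <;> intro h <;> linarith

theorem side_false_inter_nonempty (hβ : ∀ i, 0 < β i)
    (hg : ∀ K : Finset ι, 2 * ∑ i ∈ K, β i ≠ ∑ i, β i - a) (ha : 0 < ∑ i, β i + a) (i j : ι) :
    (side β a (i, false) ∩ side β a (j, false)).Nonempty ↔
      2 * ∑ k ∈ {i, j}, β k < ∑ k, β k - a := by
  have h := exists_mem_boxSlice_iff hβ hg (K := {i, j}) (I := ∅)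
  simp only [Finset.disjoint_empty_right, Finset.sum_empty, mul_zero, ha, true_and, and_true,
    Finset.notMem_empty, false_imp_iff, implies_true] at h
  rw [← h]
  simp only [Set.Nonempty, Set.mem_inter_iff, mem_side_false, Finset.mem_insert,
    Finset.mem_singleton, forall_eq_or_imp, forall_eq]
  exact exists_congr fun w => by tauto

theorem side_true_inter_nonempty (hβ : ∀ i, 0 < β i)
    (hg : ∀ K : Finset ι, 2 * ∑ i ∈ K, β i ≠ ∑ i, β i - a) (ha : 0 < ∑ i, β i - a) (i j : ι) :
    (side β a (i, true) ∩ side β a (j, true)).Nonempty ↔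
      2 * ∑ k ∈ {i, j}, β k < ∑ k, β k + a := by
  have h := exists_mem_boxSlice_iff hβ hg (K := ∅) (I := {i, j})
  simp only [Finset.disjoint_empty_left, Finset.sum_empty, mul_zero, ha, true_and,
    Finset.notMem_empty, false_imp_iff, implies_true] at h
  rw [← h]
  simp only [Set.Nonempty, Set.mem_inter_iff, mem_side_true, Finset.mem_insert,
    Finset.mem_singleton, forall_eq_or_imp, forall_eq]
  exact exists_congr fun w => by tauto

/-- A generic slice is a flagtope iff both systems of light subsets are determined by their
subsets with at most two elements. -/
theorem isFlagtope_boxSlice_iff (hβ : ∀ i, 0 < β i)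
    (hg : ∀ K : Finset ι, 2 * ∑ i ∈ K, β i ≠ ∑ i, β i - a) (ha : 0 < ∑ i, β i - a)
    (ha' : 0 < ∑ i, β i + a) :
    IsFlagtope (boxSlice β a) ↔
      (∀ K : Finset ι, (∀ i ∈ K, ∀ j ∈ K, 2 * ∑ k ∈ {i, j}, β k < ∑ k, β k - a) →
        2 * ∑ k ∈ K, β k < ∑ k, β k - a) ∧
      ∀ I : Finset ι, (∀ i ∈ I, ∀ j ∈ I, 2 * ∑ k ∈ {i, j}, β k < ∑ k, β k + a) →
        2 * ∑ k ∈ I, β k < ∑ k, β k + a := by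
  constructor
  · rintro ⟨-, hflag⟩
    refine ⟨fun K hK => ?_, fun I hI => ?_⟩
    -- The intersection of the empty collection is the whole space, so flagness yields a point of
    -- the slice only for nonempty `K`. The pairs with `i = j` express that the sides are nonempty,
    -- hence facets.
    · rcases K.eq_empty_or_nonempty with rfl | ⟨i₀, hi₀⟩
      · simpa using ha
      have hpair : ∀ i ∈ K, ∀ j ∈ K, (side β a (i, false) ∩ side β a (j, false)).Nonempty :=
        fun i hi j hj => (side_false_inter_nonempty hβ hg ha' i j).2 (hK i hi j hj)
      obtain ⟨w, hw⟩ := hflag ((fun i => side β a (i, false)) '' K)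
        (by
          rintro _ ⟨i, hi, rfl⟩
          exact (isFacet_boxSlice_iff hβ hg).2 ⟨_, (hpair i hi i hi).left, rfl⟩)
        (by
          rintro _ ⟨i, hi, rfl⟩ _ ⟨j, hj, rfl⟩
          exact hpair i hi j hj)
      have hw' : ∀ i ∈ K, w ∈ side β a (i, false) := fun i hi => hw _ ⟨i, hi, rfl⟩
      exact ((exists_mem_boxSlice_iff hβ hg (I := ∅)).1 ⟨w, (hw' i₀ hi₀).1,
        fun i hi => (mem_side_false.1 (hw' i hi)).2, by simp⟩).2.1
    · rcases I.eq_empty_or_nonempty with rfl | ⟨i₀, hi₀⟩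
      · simpa using ha'
      have hpair : ∀ i ∈ I, ∀ j ∈ I, (side β a (i, true) ∩ side β a (j, true)).Nonempty :=
        fun i hi j hj => (side_true_inter_nonempty hβ hg ha i j).2 (hI i hi j hj)
      obtain ⟨w, hw⟩ := hflag ((fun i => side β a (i, true)) '' I)
        (by
          rintro _ ⟨i, hi, rfl⟩
          exact (isFacet_boxSlice_iff hβ hg).2 ⟨_, (hpair i hi i hi).left, rfl⟩)
        (by
          rintro _ ⟨i, hi, rfl⟩ _ ⟨j, hj, rfl⟩
          exact hpair i hi j hj)
      have hw' : ∀ i ∈ I, w ∈ side β a (i, true) := fun i hi => hw _ ⟨i, hi, rfl⟩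
      exact ((exists_mem_boxSlice_iff hβ hg (K := ∅)).1 ⟨w, (hw' i₀ hi₀).1, by simp,
        fun i hi => (mem_side_true.1 (hw' i hi)).2⟩).2.2
  · rintro ⟨hK, hI⟩
    refine ⟨isSimple_boxSlice hβ hg, fun C hC hpair => ?_⟩
    classical
    set K : Finset ι := Finset.univ.filter fun i => side β a (i, false) ∈ C with hKdef
    set I : Finset ι := Finset.univ.filter fun i => side β a (i, true) ∈ C with hIdef
    have memK : ∀ i, i ∈ K ↔ side β a (i, false) ∈ C := fun i => by simp [hKdef]
    have memI : ∀ i, i ∈ I ↔ side β a (i, true) ∈ C := fun i => by simp [hIdef]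
    obtain ⟨w, hw, hwK, hwI⟩ := (exists_mem_boxSlice_iff hβ hg (K := K) (I := I)).2
      ⟨Finset.disjoint_left.2 fun i h1 h2 => by
          obtain ⟨x, hx1, hx2⟩ := hpair _ ((memK i).1 h1) _ ((memI i).1 h2)
          linarith [(mem_side_false.1 hx1).2, (mem_side_true.1 hx2).2, hβ i],
        hK K fun i hi j hj => (side_false_inter_nonempty hβ hg ha' i j).1
          (hpair _ ((memK i).1 hi) _ ((memK j).1 hj)),
        hI I fun i hi j hj => (side_true_inter_nonempty hβ hg ha i j).1
          (hpair _ ((memI i).1 hi) _ ((memI j).1 hj))⟩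
    refine ⟨w, fun F hF => ?_⟩
    obtain ⟨⟨i, b⟩, -, rfl⟩ := (isFacet_boxSlice_iff hβ hg).1 (hC F hF)
    cases b
    · exact mem_side_false.2 ⟨hw, hwK i ((memK i).2 hF)⟩
    · exact mem_side_true.2 ⟨hw, hwI i ((memI i).2 hF)⟩

end BoxSlice
/-! ### Flagness in terms of the three largest coordinates -/

section LightSets

variable {n : ℕ} {β : Fin n → ℝ} {a : ℝ}

/-- The condition on `β` and `a` under which the slice is a cube. -/
def IsCubeVector (β : Fin n → ℝ) (a : ℝ) : Prop :=
  ∃ q r : Fin n, (q : ℕ) + 2 = n ∧ (r : ℕ) + 1 = n ∧ ∑ i, β i + a < 2 * (β q + β r) ∧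
    ∑ i, β i - a < 2 * β q

/-- The condition on `β` and `a` under which the slice is a pentagon times a cube. -/
def IsPentagonVector (β : Fin n → ℝ) (a : ℝ) : Prop :=
  ∃ p q r : Fin n, (p : ℕ) + 3 = n ∧ (q : ℕ) + 2 = n ∧ (r : ℕ) + 1 = n ∧
    ∑ i, β i + a < 2 * (β p + β r) ∧ ∑ i, β i - a < 2 * β r ∧ ∑ i, β i - a < 2 * (β p + β q)

/-- The condition on `β` and `a` under which the slice is a hexagon times a cube. -/
def IsHexagonVector (β : Fin n → ℝ) (a : ℝ) : Prop :=
  ∃ p q r : Fin n, (p : ℕ) + 3 = n ∧ (q : ℕ) + 2 = n ∧ (r : ℕ) + 1 = n ∧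
    ∑ i, β i + a < 2 * (β p + β q)

theorem ne_sum_add (hg : ∀ K : Finset (Fin n), 2 * ∑ i ∈ K, β i ≠ ∑ i, β i - a)
    (K : Finset (Fin n)) : 2 * ∑ i ∈ K, β i ≠ ∑ i, β i + a := by
  have h1 := hg Kᶜ
  have h2 := Finset.sum_add_sum_compl K β
  contrapose! h1
  linarith

theorem sum_le_sub_of_notMem (hβ : ∀ i, 0 < β i) {K : Finset (Fin n)} {x : Fin n} (hx : x ∉ K) :
    ∑ i ∈ K, β i ≤ ∑ i, β i - β x := by
  rw [← Finset.sum_add_sum_compl K β]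
  have := Finset.single_le_sum (f := β) (fun i _ => (hβ i).le) (Finset.mem_compl.2 hx)
  linarith

theorem sum_le_sub_of_notMem_pair (hβ : ∀ i, 0 < β i) {K : Finset (Fin n)} {x y : Fin n}
    (hxy : x ≠ y) (hx : x ∉ K) (hy : y ∉ K) : ∑ i ∈ K, β i ≤ ∑ i, β i - (β x + β y) := by
  rw [← Finset.sum_add_sum_compl K β, ← Finset.sum_pair hxy]
  have : ∑ i ∈ {x, y}, β i ≤ ∑ i ∈ Kᶜ, β i :=
    Finset.sum_le_sum_of_subset_of_nonneg (by intro i hi; aesop) fun i _ _ => (hβ i).le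
  linarith

/-- The inequalities provide heavy singletons and pairs among the largest indices. A set with no
such subset must omit some of these indices, and bounding its sum by that of the complement of the
omitted ones shows it is light. -/
theorem light_of_cubeOrPentagonOrHexagon (hβ : ∀ i, 0 < β i) (hm : Monotone β)
    (ha : 0 < a) (h : IsCubeVector β a ∨ IsPentagonVector β a ∨ IsHexagonVector β a) :
    (∀ K : Finset (Fin n), (∀ i ∈ K, ∀ j ∈ K, 2 * ∑ k ∈ {i, j}, β k < ∑ k, β k - a) →
        2 * ∑ k ∈ K, β k < ∑ k, β k - a) ∧
      ∀ I : Finset (Fin n), (∀ i ∈ I, ∀ j ∈ I, 2 * ∑ k ∈ {i, j}, β k < ∑ k, β k + a) →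
        2 * ∑ k ∈ I, β k < ∑ k, β k + a := by
  have single : ∀ {c : ℝ} {K : Finset (Fin n)}, (∀ i ∈ K, ∀ j ∈ K, 2 * ∑ k ∈ {i, j}, β k < c) →
      ∀ x, c ≤ 2 * β x → x ∉ K := fun h x hx hxK => by
    have := h x hxK x hxK
    simp only [Finset.pair_eq_singleton, Finset.sum_singleton] at this
    linarith
  have pair : ∀ {c : ℝ} {K : Finset (Fin n)}, (∀ i ∈ K, ∀ j ∈ K, 2 * ∑ k ∈ {i, j}, β k < c) →
      ∀ x y, x ≠ y → c ≤ 2 * (β x + β y) → x ∉ K ∨ y ∉ K := fun h x y hxy hc => by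
    by_contra! hK
    have := h x hK.1 y hK.2
    rw [Finset.sum_pair hxy] at this
    linarith
  rcases h with ⟨q, r, hq, hr, h1, h2⟩ | ⟨p, q, r, hp, hq, hr, h1, h2, h3⟩ |
    ⟨p, q, r, hp, hq, hr, h1⟩
  · have hqr : q ≠ r := fun h => by omega
    have hle : β q ≤ β r := hm (Fin.le_def.2 (by omega))
    refine ⟨fun K hK => ?_, fun I hI => ?_⟩
    · have := sum_le_sub_of_notMem_pair hβ hqr (single hK q h2.le) (single hK r (by linarith))
      linarith
    · rcases pair hI q r hqr h1.le with h | h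
      · linarith [sum_le_sub_of_notMem hβ h]
      · linarith [sum_le_sub_of_notMem hβ h]
  · have hpq : p ≠ q := fun h => by omega
    have hpr : p ≠ r := fun h => by omega
    have hqr : q ≠ r := fun h => by omega
    have hle : β p ≤ β q := hm (Fin.le_def.2 (by omega))
    refine ⟨fun K hK => ?_, fun I hI => ?_⟩
    · have hrK := single hK r h2.le
      rcases pair hK p q hpq h3.le with h | h
      · linarith [sum_le_sub_of_notMem_pair hβ hpr h hrK]
      · linarith [sum_le_sub_of_notMem_pair hβ hqr h hrK]
    · by_cases hrI : r ∈ I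
      · have hpI := (pair hI p r hpr h1.le).resolve_right (not_not.2 hrI)
        have hqI := (pair hI q r hqr (by linarith)).resolve_right (not_not.2 hrI)
        linarith [sum_le_sub_of_notMem_pair hβ hpq hpI hqI]
      · linarith [sum_le_sub_of_notMem hβ hrI]
  · have hpq : p ≠ q := fun h => by omega
    have hpr : p ≠ r := fun h => by omega
    have hqr : q ≠ r := fun h => by omega
    have hle : β p ≤ β q := hm (Fin.le_def.2 (by omega))
    have hle' : β q ≤ β r := hm (Fin.le_def.2 (by omega))
    -- All pairs from `p, q, r` are heavy for the upper threshold, so for either threshold the set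
    -- omits two of these indices; this already makes it light for the lower threshold.
    have key : ∀ {c : ℝ} {K : Finset (Fin n)}, c ≤ ∑ i, β i + a →
        (∀ i ∈ K, ∀ j ∈ K, 2 * ∑ k ∈ {i, j}, β k < c) →
        2 * ∑ k ∈ K, β k < ∑ k, β k - a := fun {c K} hc hK => by
      have b1 := sum_le_sub_of_notMem_pair hβ hpq (K := K)
      have b2 := sum_le_sub_of_notMem_pair hβ hpr (K := K)
      have b3 := sum_le_sub_of_notMem_pair hβ hqr (K := K)
      rcases pair hK p q hpq (by linarith) with h | h
      · rcases pair hK q r hqr (by linarith) with h' | h'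
        · linarith [b1 h h']
        · linarith [b2 h h']
      · rcases pair hK p r hpr (by linarith) with h' | h'
        · linarith [b1 h' h]
        · linarith [b3 h h']
    exact ⟨fun K hK => key (by linarith) hK, fun I hI => (key le_rfl hI).trans (by linarith)⟩

theorem cubeOrPentagonOrHexagon_of_light (hm : Monotone β)
    (hg : ∀ K : Finset (Fin n), 2 * ∑ i ∈ K, β i ≠ ∑ i, β i - a)
    (ha' : a < ∑ i, β i) (hnt : ∀ i, 2 * β i < ∑ i, β i + a)
    (hK : ∀ K : Finset (Fin n), (∀ i ∈ K, ∀ j ∈ K, 2 * ∑ k ∈ {i, j}, β k < ∑ k, β k - a) →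
      2 * ∑ k ∈ K, β k < ∑ k, β k - a)
    (hI : ∀ I : Finset (Fin n), (∀ i ∈ I, ∀ j ∈ I, 2 * ∑ k ∈ {i, j}, β k < ∑ k, β k + a) →
      2 * ∑ k ∈ I, β k < ∑ k, β k + a) :
    IsCubeVector β a ∨ IsPentagonVector β a ∨ IsHexagonVector β a := by
  -- The complement of `K` is heavy for the upper threshold, so by flagness it contains a heavy
  -- subset with at most two elements; `hnt` rules out a singleton.
  have heavy : ∀ K : Finset (Fin n), 2 * ∑ k ∈ K, β k < ∑ k, β k - a →
      ∃ i j : Fin n, i < j ∧ i ∉ K ∧ j ∉ K ∧ ∑ k, β k + a < 2 * (β i + β j) := by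
    intro K hlt
    have h1 : ¬ 2 * ∑ k ∈ Kᶜ, β k < ∑ k, β k + a := by
      have := Finset.sum_add_sum_compl K β
      linarith
    obtain ⟨i, hi, j, hj, hij⟩ : ∃ i ∈ Kᶜ, ∃ j ∈ Kᶜ, ∑ k, β k + a ≤ 2 * ∑ k ∈ {i, j}, β k := by
      have := mt (hI Kᶜ) h1
      push Not at this
      exact this
    have hij' := lt_of_le_of_ne hij (ne_sum_add hg _).symm
    rw [Finset.mem_compl] at hi hj
    rcases lt_trichotomy i j with h | rfl | h
    · exact ⟨i, j, h, hi, hj, by rwa [Finset.sum_pair h.ne] at hij'⟩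
    · simp only [Finset.pair_eq_singleton, Finset.sum_singleton] at hij'
      exact absurd (hnt i) (not_lt.2 hij'.le)
    · exact ⟨j, i, h, hj, hi, by rw [Finset.sum_pair h.ne'] at hij'; linarith⟩
  have hgs : ∀ i, 2 * β i ≠ ∑ k, β k - a := fun i => by simpa using hg {i}
  obtain ⟨i, j, hij, -, -, h⟩ := heavy ∅ (by simpa using ha')
  have hj := j.isLt
  have hij' : (i : ℕ) < j := hij
  obtain ⟨q, hq⟩ : ∃ q : Fin n, (q : ℕ) + 2 = n := ⟨⟨n - 2, by omega⟩, by simp; omega⟩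
  obtain ⟨r, hr⟩ : ∃ r : Fin n, (r : ℕ) + 1 = n := ⟨⟨n - 1, by omega⟩, by simp; omega⟩
  have hiq : β i ≤ β q := hm (Fin.le_def.2 (by omega))
  have hjr : β j ≤ β r := hm (Fin.le_def.2 (by omega))
  rcases (hgs q).lt_or_gt with hlt | hgt
  swap
  · exact Or.inl ⟨q, r, hq, hr, by linarith, hgt⟩
  -- A heavy pair avoiding `q` exists, and by monotonicity `{p, r}` is then heavy too.
  obtain ⟨i, j, hij, hi, hj, h⟩ := heavy {q} (by simpa using hlt)
  have hjn := j.isLt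
  rw [Finset.mem_singleton, Fin.ext_iff] at hi hj
  rw [Fin.lt_def] at hij
  obtain ⟨p, hp⟩ : ∃ p : Fin n, (p : ℕ) + 3 = n := ⟨⟨n - 3, by omega⟩, by simp; omega⟩
  have hip : β i ≤ β p := hm (Fin.le_def.2 (by omega))
  have hjr : β j ≤ β r := hm (Fin.le_def.2 (by omega))
  right
  -- Since `{r}` is light for the upper threshold, its complement is heavy for the lower one and
  -- contains a heavy set with at most two elements. Singletons there are light because `{q}` is, so
  -- the largest pair `{p, q}` is heavy.
  have hpq : ∑ i, β i - a < 2 * (β p + β q) := by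
    have h1 : ¬ 2 * ∑ k ∈ Finset.univ.erase r, β k < ∑ k, β k - a := by
      have := Finset.add_sum_erase Finset.univ β (Finset.mem_univ r)
      have := hnt r
      linarith
    obtain ⟨i, hi, j, hj, hij⟩ : ∃ i ∈ Finset.univ.erase r, ∃ j ∈ Finset.univ.erase r,
        ∑ k, β k - a ≤ 2 * ∑ k ∈ {i, j}, β k := by
      have := mt (hK (Finset.univ.erase r)) h1
      push Not at this
      exact this
    have hij' := lt_of_le_of_ne hij (hg _).symm
    simp only [Finset.mem_erase, Finset.mem_univ, and_true, ne_eq, Fin.ext_iff] at hi hj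
    have hin := i.isLt
    have hjn := j.isLt
    have hiq : β i ≤ β q := hm (Fin.le_def.2 (by omega))
    have hjq : β j ≤ β q := hm (Fin.le_def.2 (by omega))
    rcases lt_trichotomy (i : ℕ) j with h | h | h
    · have hip : β i ≤ β p := hm (Fin.le_def.2 (by omega))
      rw [Finset.sum_pair (fun e => by omega)] at hij'
      linarith
    · obtain rfl : i = j := Fin.ext h
      simp only [Finset.pair_eq_singleton, Finset.sum_singleton] at hij'
      linarith
    · have hip : β j ≤ β p := hm (Fin.le_def.2 (by omega))
      rw [Finset.sum_pair (fun e => by omega)] at hij'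
      linarith
  rcases (hgs r).lt_or_gt with hlt' | hgt'
  swap
  · exact Or.inl ⟨p, q, r, hp, hq, hr, by linarith, hgt', hpq⟩
  obtain ⟨i, j, hij, hi, hj, h⟩ := heavy {r} (by simpa using hlt')
  have hjn := j.isLt
  rw [Finset.mem_singleton, Fin.ext_iff] at hi hj
  rw [Fin.lt_def] at hij
  have hip : β i ≤ β p := hm (Fin.le_def.2 (by omega))
  have hjq : β j ≤ β q := hm (Fin.le_def.2 (by omega))
  exact Or.inr ⟨p, q, r, hp, hq, hr, by linarith⟩

end LightSets

/-! ### Short codes -/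

section Codes

variable {n : ℕ}

theorem subsetLE_of_subset {I J : Finset (Fin (n + 1))} (h : I ⊆ J) : SubsetLE I J :=
  ⟨id, Set.injOn_id _, fun _ hi => ⟨h hi, le_rfl⟩⟩

theorem SubsetLE.trans {I J K : Finset (Fin (n + 1))} (h : SubsetLE I J) (h' : SubsetLE J K) :
    SubsetLE I K := by
  obtain ⟨f, hf, hfJ⟩ := h
  obtain ⟨g, hg, hgK⟩ := h'
  exact ⟨g ∘ f, hg.comp hf fun i hi => (hfJ i hi).1,
    fun i hi => ⟨(hgK _ (hfJ i hi).1).1, (hfJ i hi).2.trans (hgK _ (hfJ i hi).1).2⟩⟩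

theorem subsetLE_of_replace {J A : Finset (Fin (n + 1))} {x z : Fin (n + 1)} (hxz : x ≤ z)
    (hzA : z ∈ A) (hzJ : z ∉ J) (h : ∀ i ∈ J, i ≠ x → i ∈ A) : SubsetLE J A := by
  refine ⟨fun i => if i = x then z else i, fun i hi j hj hij => ?_, fun i hi => ?_⟩
  · by_cases h1 : i = x <;> by_cases h2 : j = x
    · rw [h1, h2]
    · simp only [h1, h2, if_true, if_false] at hij
      exact absurd (hij ▸ hj) hzJ
    · simp only [h1, h2, if_true, if_false] at hij
      exact absurd (hij ▸ hi) hzJ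
    · simpa [h1, h2] using hij
  · by_cases h1 : i = x
    · simpa [h1] using ⟨hzA, hxz⟩
    · simpa [h1] using h i hi h1

/-- The injection never decreases an index, so it preserves the part from `t` on. This is the
obstruction used to show that a set does not precede a gene. -/
theorem SubsetLE.card_filter_le {I J : Finset (Fin (n + 1))} (h : SubsetLE I J) (t : Fin (n + 1)) :
    (I.filter (t ≤ ·)).card ≤ (J.filter (t ≤ ·)).card := by
  obtain ⟨f, hf, hfJ⟩ := h
  refine Finset.card_le_card_of_injOn f (fun i hi => ?_) (hf.mono (Finset.filter_subset _ _))
  have hi' := Finset.mem_filter.1 (Finset.mem_coe.1 hi)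
  exact Finset.mem_coe.2 (Finset.mem_filter.2 ⟨(hfJ i hi'.1).1, hi'.2.trans (hfJ i hi'.1).2⟩)

theorem SubsetLE.sum_label_le {I J : Finset (Fin (n + 1))} (h : SubsetLE I J) :
    ∑ i ∈ I, label i ≤ ∑ j ∈ J, label j := by
  obtain ⟨f, hf, hfJ⟩ := h
  calc ∑ i ∈ I, label i ≤ ∑ i ∈ I, label (f i) :=
        Finset.sum_le_sum fun i hi => Nat.succ_le_succ (hfJ i hi).2
    _ = ∑ j ∈ I.image f, label j := (Finset.sum_image hf).symm
    _ ≤ ∑ j ∈ J, label j :=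
        Finset.sum_le_sum_of_subset (Finset.image_subset_iff.2 fun i hi => (hfJ i hi).1)

/-- The sum of labels is strictly increasing for the order. Labels start at 1, so even adding the
index 0 increases it. -/
theorem SubsetLE.eq_of_sum_label_le {I J : Finset (Fin (n + 1))} (h : SubsetLE I J)
    (hw : ∑ j ∈ J, label j ≤ ∑ i ∈ I, label i) : J = I := by
  obtain ⟨f, hf, hfJ⟩ := h
  have h1 : ∀ i ∈ I, label i ≤ label (f i) := fun i hi => Nat.succ_le_succ (hfJ i hi).2
  have hsub : I.image f ⊆ J := Finset.image_subset_iff.2 fun i hi => (hfJ i hi).1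
  have h2 : ∑ j ∈ I.image f, label j = ∑ i ∈ I, label (f i) := Finset.sum_image hf
  have h3 := Finset.sum_le_sum h1
  have h4 := Finset.sum_le_sum_of_subset (f := label) hsub
  have hfi : ∀ i ∈ I, f i = i := fun i hi => by
    have := (Finset.sum_eq_sum_iff_of_le h1).1 (by omega) i hi
    simp only [label] at this
    exact Fin.ext (by omega)
  have himg : I.image f = I := by
    rw [Finset.image_congr (g := id) hfi, Finset.image_id]
  rw [himg] at hsub
  refine (Finset.Subset.antisymm hsub fun j hj => ?_).symm
  by_contra hjI
  have := Finset.sum_lt_sum_of_subset hsub hj hjI (f := label) (Nat.succ_pos _)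
    fun _ _ _ => Nat.zero_le _
  omega

/-- By finiteness every short set lies below a maximal one, found by maximizing the sum of labels; a
unique maximal element is therefore a greatest element. -/
theorem shortCode_eq_singleton_iff {α : Fin (n + 1) → ℝ} {A : Finset (Fin (n + 1))} :
    shortCode α = {A} ↔ A ∈ shortSubsets α ∧ ∀ J ∈ shortSubsets α, SubsetLE J A := by
  classical
  constructor
  · intro h
    have hA : A ∈ shortCode α := h ▸ rfl
    refine ⟨hA.1, fun J hJ => ?_⟩
    obtain ⟨B, hB, hmax⟩ := Finset.exists_max_image
      (Finset.univ.filter fun B => B ∈ shortSubsets α ∧ SubsetLE J B) (fun B => ∑ i ∈ B, label i)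
      ⟨J, by simpa using ⟨hJ, subsetLE_of_subset subset_rfl⟩⟩
    simp only [Finset.mem_filter, Finset.mem_univ, true_and, and_imp] at hB hmax
    have hBc : B ∈ shortCode α := ⟨hB.1, fun B' hB' hBB' =>
      hBB'.eq_of_sum_label_le (hmax B' hB' (hB.2.trans hBB'))⟩
    rw [h, Set.mem_singleton_iff] at hBc
    exact hBc ▸ hB.2
  · rintro ⟨hA, hmax⟩
    refine Set.ext fun J => ⟨fun hJ => (hJ.2 A hA (hmax J hJ.1)).symm, ?_⟩
    rintro rfl
    exact ⟨hA, fun B hB hJB => hJB.eq_of_sum_label_le (hmax B hB).sum_label_le⟩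

/-- The part of `J` below the last index. -/
def lower (J : Finset (Fin (n + 1))) : Finset (Fin n) :=
  Finset.univ.filter fun i => i.castSucc ∈ J

theorem mem_lower {J : Finset (Fin (n + 1))} {i : Fin n} : i ∈ lower J ↔ i.castSucc ∈ J := by
  simp [lower]

/-- The bridge from codes to the polytope: the right side is lightness for the lower threshold. -/
theorem mem_shortSubsets_iff {α : Fin (n + 1) → ℝ} {J : Finset (Fin (n + 1))} :
    J ∈ shortSubsets α ↔ Fin.last n ∈ J ∧
      2 * ∑ i ∈ lower J, α i.castSucc < ∑ i : Fin n, α i.castSucc - α (Fin.last n) := by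
  refine and_congr_right fun hJ => ?_
  have h1 := Finset.sum_add_sum_compl J α
  have h2 : ∑ i ∈ J, α i = ∑ i ∈ lower J, α i.castSucc + α (Fin.last n) := by
    rw [show ∑ i ∈ J, α i = ∑ i, if i ∈ J then α i else 0 by simp, Fin.sum_univ_castSucc]
    simp [hJ, lower, Finset.sum_filter]
  rw [Fin.sum_univ_castSucc] at h1
  rw [IsShort]
  constructor <;> intro h <;> linarith

/-! ### Single-gene codes as inequalities on the largest entries -/

section Genes

variable {α : Fin (n + 1) → ℝ}

theorem mem_geneTorus {i : Fin n} : i.castSucc ∈ geneTorus n ↔ (i : ℕ) + 2 ≤ n := by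
  simp [geneTorus, label]
  omega

theorem mem_geneCube {i : Fin n} : i.castSucc ∈ geneCube n ↔ (i : ℕ) + 3 ≤ n := by
  simp [geneCube, label]
  omega

theorem mem_genePentagon {i : Fin n} :
    i.castSucc ∈ genePentagon n ↔ (i : ℕ) + 4 ≤ n ∨ (i : ℕ) + 2 = n := by
  simp [genePentagon, label]
  omega

theorem mem_geneHexagon {i : Fin n} :
    i.castSucc ∈ geneHexagon n ↔ (i : ℕ) + 4 ≤ n ∨ (i : ℕ) + 1 = n := by
  simp [geneHexagon, label]
  omega

theorem last_mem_geneTorus : Fin.last n ∈ geneTorus n := by simp [geneTorus, label]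

theorem last_mem_geneCube : Fin.last n ∈ geneCube n := by simp [geneCube, label]

theorem last_mem_genePentagon : Fin.last n ∈ genePentagon n := by simp [genePentagon, label]

theorem last_mem_geneHexagon : Fin.last n ∈ geneHexagon n := by simp [geneHexagon, label]

theorem sum_lower_eq_sub_pair {β : Fin n → ℝ} {J : Finset (Fin (n + 1))} {x y : Fin n}
    (hxy : x ≠ y) (h : ∀ i : Fin n, i.castSucc ∈ J ↔ i ≠ x ∧ i ≠ y) :
    ∑ i ∈ lower J, β i = ∑ i, β i - (β x + β y) := by
  have hc : (lower J)ᶜ = {x, y} := by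
    ext i
    rw [Finset.mem_compl, mem_lower, h, Finset.mem_insert, Finset.mem_singleton]
    tauto
  rw [← Finset.sum_add_sum_compl (lower J), hc, Finset.sum_pair hxy]
  ring

theorem two_mul_lt_of_mem (hβ : ∀ i : Fin n, 0 < α i.castSucc) {J : Finset (Fin (n + 1))}
    (hJ : J ∈ shortSubsets α) {x : Fin n} (hx : x.castSucc ∈ J) :
    2 * α x.castSucc < ∑ i : Fin n, α i.castSucc - α (Fin.last n) := by
  have := Finset.single_le_sum (f := fun i : Fin n => α i.castSucc) (fun i _ => (hβ i).le)
    (mem_lower.2 hx)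
  linarith [(mem_shortSubsets_iff.1 hJ).2]

theorem two_mul_add_lt_of_mem (hβ : ∀ i : Fin n, 0 < α i.castSucc) {J : Finset (Fin (n + 1))}
    (hJ : J ∈ shortSubsets α) {x y : Fin n} (hxy : x ≠ y) (hx : x.castSucc ∈ J)
    (hy : y.castSucc ∈ J) :
    2 * (α x.castSucc + α y.castSucc) < ∑ i : Fin n, α i.castSucc - α (Fin.last n) := by
  have : ∑ i ∈ {x, y}, α i.castSucc ≤ ∑ i ∈ lower J, α i.castSucc :=
    Finset.sum_le_sum_of_subset_of_nonneg
      (by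
        intro i hi
        rw [Finset.mem_insert, Finset.mem_singleton] at hi
        rcases hi with rfl | rfl
        · exact mem_lower.2 hx
        · exact mem_lower.2 hy)
      fun i _ _ => (hβ i).le
  rw [Finset.sum_pair hxy] at this
  linarith [(mem_shortSubsets_iff.1 hJ).2]

theorem subsetLE_gene_of_replace {J A : Finset (Fin (n + 1))} (hA : Fin.last n ∈ A) {x z : Fin n}
    (hxz : x ≤ z) (hzA : z.castSucc ∈ A) (hzJ : z.castSucc ∉ J)
    (h : ∀ i : Fin n, i.castSucc ∈ J → i ≠ x → i.castSucc ∈ A) : SubsetLE J A := by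
  refine subsetLE_of_replace (x := x.castSucc) (z := z.castSucc)
    (Fin.castSucc_le_castSucc_iff.2 hxz) hzA hzJ fun i => ?_
  refine Fin.lastCases (fun _ _ => hA) (fun i hi hix => h i hi fun e => hix (e ▸ rfl)) i

theorem subset_gene {J A : Finset (Fin (n + 1))} (hA : Fin.last n ∈ A)
    (h : ∀ i : Fin n, i.castSucc ∈ J → i.castSucc ∈ A) : J ⊆ A := fun i =>
  Fin.lastCases (fun _ => hA) (fun i hi => h i hi) i

theorem insert_last_mem_shortSubsets_iff {K : Finset (Fin n)} :
    insert (Fin.last n) (K.map Fin.castSuccEmb) ∈ shortSubsets α ↔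
      2 * ∑ i ∈ K, α i.castSucc < ∑ i : Fin n, α i.castSucc - α (Fin.last n) := by
  have : lower (insert (Fin.last n) (K.map Fin.castSuccEmb)) = K := by
    ext i
    simp [mem_lower, Fin.castSucc_ne_last]
  rw [mem_shortSubsets_iff, this]
  simp

/-- If `A` has, below the last index, fewer elements than `K` from the index `t` on, then
`K ∪ {last}` does not precede `A`. -/
theorem not_subsetLE_of_subset {K L : Finset (Fin n)} {A : Finset (Fin (n + 1))} {t : Fin n}
    (hK : ∀ i ∈ K, t ≤ i) (hA : ∀ i : Fin n, t ≤ i → i.castSucc ∈ A → i ∈ L)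
    (hcard : L.card < K.card) : ¬ SubsetLE (insert (Fin.last n) (K.map Fin.castSuccEmb)) A := by
  intro h
  have h1 := h.card_filter_le t.castSucc
  have hl : ∀ M : Finset (Fin n), Fin.last n ∉ M.map Fin.castSuccEmb := fun M => by
    simp [Fin.castSucc_ne_last]
  have h2 : (insert (Fin.last n) (K.map Fin.castSuccEmb)).filter (t.castSucc ≤ ·) =
      insert (Fin.last n) (K.map Fin.castSuccEmb) := by
    refine Finset.filter_true_of_mem fun i hi => ?_
    rcases Finset.mem_insert.1 hi with rfl | hi
    · exact Fin.le_last _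
    · obtain ⟨j, hj, rfl⟩ := Finset.mem_map.1 hi
      exact Fin.castSucc_le_castSucc_iff.2 (hK j hj)
  have h3 : A.filter (t.castSucc ≤ ·) ⊆ insert (Fin.last n) (L.map Fin.castSuccEmb) := fun i =>
    Fin.lastCases (fun _ => Finset.mem_insert_self _ _) (fun i hi => by
      obtain ⟨hi1, hi2⟩ := Finset.mem_filter.1 hi
      exact Finset.mem_insert_of_mem (Finset.mem_map.2
        ⟨i, hA i (Fin.castSucc_le_castSucc_iff.1 hi2) hi1, rfl⟩)) i
  have h4 := Finset.card_le_card h3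
  rw [h2, Finset.card_insert_of_notMem (hl K), Finset.card_map] at h1
  rw [Finset.card_insert_of_notMem (hl L), Finset.card_map] at h4
  omega

/-- The inequalities satisfied by a chain vector, in terms of its first entries. -/
structure IsReduced (β : Fin n → ℝ) (a : ℝ) : Prop where
  pos : ∀ i, 0 < β i
  mono : Monotone β
  pos_last : 0 < a
  last_lt : a < ∑ i, β i
  generic : ∀ K : Finset (Fin n), 2 * ∑ i ∈ K, β i ≠ ∑ i, β i - a

theorem IsChainVector.isReduced (h : IsChainVector α) :
    IsReduced (fun i : Fin n => α i.castSucc) (α (Fin.last n)) where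
  pos i := h.pos _
  mono := h.mono
  pos_last := h.pos _
  last_lt := h.last_lt
  generic K hK := by
    -- The sign is negative on `K` and on the last entry, so the signed sum is ∑ β - 2 ∑_K β - a.
    refine h.generic (Fin.lastCases (-1) fun i => if i ∈ K then -1 else 1) (fun i => ?_) ?_
    · refine Fin.lastCases (by simp) (fun i => ?_) i
      by_cases hi : i ∈ K <;> simp [hi]
    · rw [Fin.sum_univ_castSucc]
      simp only [Fin.lastCases_castSucc, Fin.lastCases_last]
      have : ∀ i : Fin n, (if i ∈ K then -1 else 1) * α i.castSucc =
          α i.castSucc - 2 * if i ∈ K then α i.castSucc else 0 := fun i => by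
        split_ifs <;> ring
      simp only [this, Finset.sum_sub_distrib, ← Finset.mul_sum, Finset.sum_ite_mem,
        Finset.univ_inter]
      linarith

/-- If some entry violates the bound, so does the largest one, at `r`. Then `geneTorus n`, which
omits only `r`, is short, and no short set containing the last index contains `r`, so every one is a
subset of this gene. -/
theorem two_mul_lt_of_shortCode_ne (h : IsChainVector α) (hT : shortCode α ≠ {geneTorus n})
    (i : Fin n) : 2 * α i.castSucc < ∑ i : Fin n, α i.castSucc + α (Fin.last n) := by
  have hR := h.isReduced
  by_contra hcon
  refine hT ?_
  have hin := i.isLt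
  obtain ⟨r, hr⟩ : ∃ r : Fin n, (r : ℕ) + 1 = n := ⟨⟨n - 1, by omega⟩, by simp; omega⟩
  have hir : α i.castSucc ≤ α r.castSucc := hR.mono (Fin.le_def.2 (by omega))
  have hne := ne_sum_add hR.generic {r}
  rw [Finset.sum_singleton] at hne
  have hlt := lt_of_le_of_ne ((not_lt.1 hcon).trans (by linarith)) hne.symm
  refine shortCode_eq_singleton_iff.2 ⟨mem_shortSubsets_iff.2 ⟨last_mem_geneTorus, ?_⟩,
    fun J hJ => subsetLE_of_subset (subset_gene last_mem_geneTorus fun j hj => ?_)⟩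
  · have : lower (geneTorus n) = Finset.univ.erase r := by
      ext j
      rw [mem_lower, mem_geneTorus, Finset.mem_erase, ne_eq, Fin.ext_iff]
      have := j.isLt
      simp
      omega
    have h2 := Finset.add_sum_erase Finset.univ (fun i : Fin n => α i.castSucc) (Finset.mem_univ r)
    rw [this]
    linarith
  · rw [mem_geneTorus]
    have hjn := j.isLt
    by_contra hj'
    obtain rfl : j = r := Fin.ext (by omega)
    have := two_mul_lt_of_mem hR.pos hJ hj
    linarith [hR.pos_last]

theorem two_le_of_isReduced {β : Fin n → ℝ} {a : ℝ} (h : IsReduced β a)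
    (hnt : ∀ i, 2 * β i < ∑ i, β i + a) : 2 ≤ n := by
  by_contra hn
  obtain rfl | rfl : n = 0 ∨ n = 1 := by omega
  · have h1 := h.pos_last
    have h2 := h.last_lt
    simp only [Finset.univ_eq_empty, Finset.sum_empty] at h2
    linarith
  · have h1 := hnt 0
    have h2 := h.last_lt
    simp only [Fin.sum_univ_one] at h1 h2
    linarith

/-- Shortness of the gene says that the omitted pair `{q, r}` is heavy for the upper threshold. That
it dominates all short sets is tested on `{q}` together with the last index, which does not precede
the gene. -/
theorem shortCode_eq_geneCube_iff (h : IsChainVector α)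
    (hnt : ∀ i : Fin n, 2 * α i.castSucc < ∑ i : Fin n, α i.castSucc + α (Fin.last n)) :
    shortCode α = {geneCube n} ↔
      IsCubeVector (fun i : Fin n => α i.castSucc) (α (Fin.last n)) := by
  have hR := h.isReduced
  have hn := two_le_of_isReduced hR hnt
  rw [shortCode_eq_singleton_iff]
  have hlower : ∀ q r : Fin n, (q : ℕ) + 2 = n → (r : ℕ) + 1 = n →
      ∑ i ∈ lower (geneCube n), α i.castSucc =
        ∑ i : Fin n, α i.castSucc - (α q.castSucc + α r.castSucc) := fun q r hq hr =>
    sum_lower_eq_sub_pair (β := fun i : Fin n => α i.castSucc) (fun e => by omega) fun i => by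
      have := i.isLt
      rw [mem_geneCube, ne_eq, ne_eq, Fin.ext_iff, Fin.ext_iff]
      omega
  constructor
  · rintro ⟨hA, hmax⟩
    obtain ⟨q, hq⟩ : ∃ q : Fin n, (q : ℕ) + 2 = n := ⟨⟨n - 2, by omega⟩, by simp; omega⟩
    obtain ⟨r, hr⟩ : ∃ r : Fin n, (r : ℕ) + 1 = n := ⟨⟨n - 1, by omega⟩, by simp; omega⟩
    have h1 := (mem_shortSubsets_iff.1 hA).2
    rw [hlower q r hq hr] at h1
    refine ⟨q, r, hq, hr, by dsimp only; linarith, ?_⟩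
    have hne := hR.generic {q}
    rw [Finset.sum_singleton] at hne
    refine lt_of_le_of_ne ?_ hne.symm
    by_contra hlt
    refine not_subsetLE_of_subset (K := {q}) (L := ∅) (t := q) (by simp) (fun i hi hiA => ?_)
      (by simp) (hmax _ (insert_last_mem_shortSubsets_iff.2
          (by rw [Finset.sum_singleton]; exact not_le.1 hlt)))
    rw [mem_geneCube] at hiA
    rw [Fin.le_def] at hi
    omega
  · rintro ⟨q, r, hq, hr, h1, h2⟩
    dsimp only at h1 h2
    refine ⟨mem_shortSubsets_iff.2 ⟨last_mem_geneCube, ?_⟩,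
      fun J hJ => subsetLE_of_subset (subset_gene last_mem_geneCube fun j hj => ?_)⟩
    · rw [hlower q r hq hr]
      linarith
    · rw [mem_geneCube]
      by_contra hj'
      have h3 : α q.castSucc ≤ α j.castSucc := hR.mono (Fin.le_def.2 (by omega))
      linarith [two_mul_lt_of_mem hR.pos hJ hj]

/-- Here the omitted pair is `{p, r}`, and domination is tested on `{r}` and on `{p, q}`, each with
the last index added. Conversely a short set omits `r` and one of `p, q`; if it contains `p`, moving
`p` to `q` puts it inside the gene. -/
theorem shortCode_eq_genePentagon_iff (h : IsChainVector α)
    (hnt : ∀ i : Fin n, 2 * α i.castSucc < ∑ i : Fin n, α i.castSucc + α (Fin.last n)) :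
    shortCode α = {genePentagon n} ↔
      IsPentagonVector (fun i : Fin n => α i.castSucc) (α (Fin.last n)) := by
  have hR := h.isReduced
  have hn := two_le_of_isReduced hR hnt
  rw [shortCode_eq_singleton_iff]
  have hlower : ∀ p r : Fin n, (p : ℕ) + 3 = n → (r : ℕ) + 1 = n →
      ∑ i ∈ lower (genePentagon n), α i.castSucc =
        ∑ i : Fin n, α i.castSucc - (α p.castSucc + α r.castSucc) := fun p r hp hr =>
    sum_lower_eq_sub_pair (β := fun i : Fin n => α i.castSucc) (fun e => by omega) fun i => by
      have := i.isLt
      rw [mem_genePentagon, ne_eq, ne_eq, Fin.ext_iff, Fin.ext_iff]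
      omega
  constructor
  · rintro ⟨hA, hmax⟩
    obtain ⟨q, hq⟩ : ∃ q : Fin n, (q : ℕ) + 2 = n := ⟨⟨n - 2, by omega⟩, by simp; omega⟩
    obtain ⟨r, hr⟩ : ∃ r : Fin n, (r : ℕ) + 1 = n := ⟨⟨n - 1, by omega⟩, by simp; omega⟩
    have hqA := two_mul_lt_of_mem hR.pos hA (mem_genePentagon.2 (Or.inr hq))
    -- For n = 2 there is no index `p`; the gene being short then contradicts the bound on the entry
    -- of index 1.
    obtain rfl | hn3 : n = 2 ∨ 3 ≤ n := by omega
    · obtain rfl : q = 0 := Fin.ext (by simpa using hq)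
      have := hnt 1
      simp only [Fin.sum_univ_two] at this hqA
      linarith
    obtain ⟨p, hp⟩ : ∃ p : Fin n, (p : ℕ) + 3 = n := ⟨⟨n - 3, by omega⟩, by simp; omega⟩
    have hpq : p ≠ q := fun e => by omega
    have h1 := (mem_shortSubsets_iff.1 hA).2
    rw [hlower p r hp hr] at h1
    refine ⟨p, q, r, hp, hq, hr, by dsimp only; linarith, ?_, ?_⟩
    · have hne := hR.generic {r}
      rw [Finset.sum_singleton] at hne
      refine lt_of_le_of_ne ?_ hne.symm
      by_contra hlt
      refine not_subsetLE_of_subset (K := {r}) (L := ∅) (t := r) (by simp) (fun i hi hiA => ?_)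
        (by simp) (hmax _ (insert_last_mem_shortSubsets_iff.2
          (by rw [Finset.sum_singleton]; exact not_le.1 hlt)))
      rw [mem_genePentagon] at hiA
      rw [Fin.le_def] at hi
      omega
    · have hne := hR.generic {p, q}
      rw [Finset.sum_pair hpq] at hne
      refine lt_of_le_of_ne ?_ hne.symm
      by_contra hlt
      refine not_subsetLE_of_subset (K := {p, q}) (L := {q}) (t := p) ?_ (fun i hi hiA => ?_)
        (by rw [Finset.card_pair hpq, Finset.card_singleton]; omega)
        (hmax _ (insert_last_mem_shortSubsets_iff.2
          (by rw [Finset.sum_pair hpq]; exact not_le.1 hlt)))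
      · simp only [Finset.mem_insert, Finset.mem_singleton, forall_eq_or_imp, forall_eq, le_refl,
          true_and]
        exact Fin.le_def.2 (by omega)
      · rw [mem_genePentagon] at hiA
        rw [Fin.le_def] at hi
        exact Finset.mem_singleton.2 (Fin.ext (by omega))
  · rintro ⟨p, q, r, hp, hq, hr, h1, h2, h3⟩
    dsimp only at h1 h2 h3
    have hpq : p ≠ q := fun e => by omega
    refine ⟨mem_shortSubsets_iff.2 ⟨last_mem_genePentagon, ?_⟩, fun J hJ => ?_⟩
    · rw [hlower p r hp hr]
      linarith
    have hrJ : r.castSucc ∉ J := fun hrJ => by linarith [two_mul_lt_of_mem hR.pos hJ hrJ]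
    have hmem : ∀ i : Fin n, i.castSucc ∈ J → i ≠ p → i.castSucc ∈ genePentagon n :=
      fun i hi hip => by
        have hir : i ≠ r := fun e => hrJ (e ▸ hi)
        rw [ne_eq, Fin.ext_iff] at hip hir
        rw [mem_genePentagon]
        omega
    by_cases hpJ : p.castSucc ∈ J
    · refine subsetLE_gene_of_replace last_mem_genePentagon (x := p) (z := q)
        (Fin.le_def.2 (by omega)) (mem_genePentagon.2 (Or.inr hq)) (fun hqJ => ?_) hmem
      linarith [two_mul_add_lt_of_mem hR.pos hJ hpq hpJ hqJ]
    · exact subsetLE_of_subset (subset_gene last_mem_genePentagon fun i hi =>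
        hmem i hi fun e => hpJ (e ▸ hi))

/-- Domination is automatic here: once `{p, q}` is heavy, so is every pair from `p, q, r`. A short
set thus contains at most one of the three, which can be moved to `r`. -/
theorem shortCode_eq_geneHexagon_iff (h : IsChainVector α)
    (hnt : ∀ i : Fin n, 2 * α i.castSucc < ∑ i : Fin n, α i.castSucc + α (Fin.last n)) :
    shortCode α = {geneHexagon n} ↔
      IsHexagonVector (fun i : Fin n => α i.castSucc) (α (Fin.last n)) := by
  have hR := h.isReduced
  have hn := two_le_of_isReduced hR hnt
  rw [shortCode_eq_singleton_iff]
  have hlower : ∀ p q : Fin n, (p : ℕ) + 3 = n → (q : ℕ) + 2 = n →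
      ∑ i ∈ lower (geneHexagon n), α i.castSucc =
        ∑ i : Fin n, α i.castSucc - (α p.castSucc + α q.castSucc) := fun p q hp hq =>
    sum_lower_eq_sub_pair (β := fun i : Fin n => α i.castSucc) (fun e => by omega) fun i => by
      have := i.isLt
      rw [mem_geneHexagon, ne_eq, ne_eq, Fin.ext_iff, Fin.ext_iff]
      omega
  constructor
  · rintro ⟨hA, -⟩
    obtain ⟨q, hq⟩ : ∃ q : Fin n, (q : ℕ) + 2 = n := ⟨⟨n - 2, by omega⟩, by simp; omega⟩
    obtain ⟨r, hr⟩ : ∃ r : Fin n, (r : ℕ) + 1 = n := ⟨⟨n - 1, by omega⟩, by simp; omega⟩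
    have hrA := two_mul_lt_of_mem hR.pos hA (mem_geneHexagon.2 (Or.inr hr))
    obtain rfl | hn3 : n = 2 ∨ 3 ≤ n := by omega
    · obtain rfl : r = 1 := Fin.ext (by simpa using hr)
      have h01 : α (Fin.castSucc (0 : Fin 2)) ≤ α (Fin.castSucc (1 : Fin 2)) :=
        hR.mono (Fin.zero_le _)
      have := hR.pos_last
      simp only [Fin.sum_univ_two] at hrA
      linarith
    obtain ⟨p, hp⟩ : ∃ p : Fin n, (p : ℕ) + 3 = n := ⟨⟨n - 3, by omega⟩, by simp; omega⟩
    have h1 := (mem_shortSubsets_iff.1 hA).2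
    rw [hlower p q hp hq] at h1
    exact ⟨p, q, r, hp, hq, hr, by dsimp only; linarith⟩
  · rintro ⟨p, q, r, hp, hq, hr, h1⟩
    dsimp only at h1
    have ha := hR.pos_last
    have hpq : p ≠ q := fun e => by omega
    have hpr : p ≠ r := fun e => by omega
    have hqr : q ≠ r := fun e => by omega
    have hle : α p.castSucc ≤ α q.castSucc := hR.mono (Fin.le_def.2 (by omega))
    have hle' : α q.castSucc ≤ α r.castSucc := hR.mono (Fin.le_def.2 (by omega))
    refine ⟨mem_shortSubsets_iff.2 ⟨last_mem_geneHexagon, ?_⟩, fun J hJ => ?_⟩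
    · rw [hlower p q hp hq]
      linarith
    have hmem : ∀ i : Fin n, i.castSucc ∈ J → i ≠ p → i ≠ q → i.castSucc ∈ geneHexagon n :=
      fun i hi hip hiq => by
        have := i.isLt
        rw [ne_eq, Fin.ext_iff] at hip hiq
        rw [mem_geneHexagon]
        omega
    have pair : ∀ x y : Fin n, x ≠ y →
        ∑ i : Fin n, α i.castSucc + α (Fin.last n) < 2 * (α x.castSucc + α y.castSucc) →
        x.castSucc ∈ J → y.castSucc ∉ J := fun x y hxy hlt hx hy => by
      linarith [two_mul_add_lt_of_mem hR.pos hJ hxy hx hy]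
    have hrA := mem_geneHexagon.2 (Or.inr hr)
    by_cases hpJ : p.castSucc ∈ J
    · exact subsetLE_gene_of_replace last_mem_geneHexagon (x := p) (z := r)
        (Fin.le_def.2 (by omega)) hrA (pair p r hpr (by linarith) hpJ) fun i hi hip =>
          hmem i hi hip fun e => pair p q hpq h1 hpJ (e ▸ hi)
    by_cases hqJ : q.castSucc ∈ J
    · exact subsetLE_gene_of_replace last_mem_geneHexagon (x := q) (z := r)
        (Fin.le_def.2 (by omega)) hrA (pair q r hqr (by linarith) hqJ) fun i hi hiq =>
          hmem i hi (fun e => hpJ (e ▸ hi)) hiq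
    · exact subsetLE_of_subset (subset_gene last_mem_geneHexagon fun i hi =>
        hmem i hi (fun e => hpJ (e ▸ hi)) fun e => hqJ (e ▸ hi))

end Genes

end Codes
/-! ### Combinatorial types -/

/-- If `(b, r)` and `(b', r')` have the same light sets, then every point of the slice of the box
`∏ [0, b i]` by the hyperplane of coordinate sum `r` has a counterpart in the slice given by
`(b', r')`. -/
theorem exists_same_pattern {ι : Type*} [Fintype ι] [DecidableEq ι] {b b' : ι → ℝ} {r r' : ℝ}
    (hb : ∀ i, 0 < b i) (hb' : ∀ i, 0 < b' i)
    (h : ∀ K : Finset ι, (∑ i ∈ K, b i < r ∧ ∑ i ∈ K, b' i < r') ∨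
      (r < ∑ i ∈ K, b i ∧ r' < ∑ i ∈ K, b' i))
    {u : ι → ℝ} (hu : ∀ i, 0 ≤ u i ∧ u i ≤ b i) (hur : ∑ i, u i = r) :
    ∃ u' : ι → ℝ, (∀ i, 0 ≤ u' i ∧ u' i ≤ b' i) ∧ ∑ i, u' i = r' ∧
      ∀ i, (u i = 0 ↔ u' i = 0) ∧ (u i = b i ↔ u' i = b' i) := by
  classical
  -- With `M` the coordinates strictly inside, ∑_K b ≤ r ≤ ∑_{K ∪ M} b. Equal light sets turn this
  -- into strict inequalities for `b'` and `r'`, so a common factor `t` in (0, 1) on `M` reaches the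
  -- sum `r'`.
  set K : Finset ι := Finset.univ.filter fun i => u i = b i with hK
  set M : Finset ι := Finset.univ.filter fun i => u i ≠ b i ∧ u i ≠ 0 with hM
  have hdisj : Disjoint K M := Finset.disjoint_filter.2 fun i _ h1 h2 => h2.1 h1
  have hle : ∑ i ∈ K, b i ≤ r := by
    rw [← hur, Finset.sum_congr rfl fun i hi => ((Finset.mem_filter.1 hi).2).symm]
    exact Finset.sum_le_sum_of_subset_of_nonneg (Finset.subset_univ _) fun i _ _ => (hu i).1
  have hge : r ≤ ∑ i ∈ K ∪ M, b i := by
    rw [← hur, ← Finset.sum_subset (Finset.subset_univ (K ∪ M)) fun i _ hi => ?_]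
    · exact Finset.sum_le_sum fun i _ => (hu i).2
    · simp only [hK, hM, Finset.mem_union, Finset.mem_filter, Finset.mem_univ, true_and] at hi
      tauto
  have hKlt : ∑ i ∈ K, b' i < r' := by
    rcases h K with h | h
    · exact h.2
    · linarith [h.1]
  have hKM : r' < ∑ i ∈ K, b' i + ∑ i ∈ M, b' i := by
    rw [← Finset.sum_union hdisj]
    rcases h (K ∪ M) with h | h
    · linarith [h.1]
    · exact h.2
  have hpos : 0 < ∑ i ∈ M, b' i := by linarith
  set t := (r' - ∑ i ∈ K, b' i) / ∑ i ∈ M, b' i with ht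
  have ht0 : 0 < t := div_pos (by linarith) hpos
  have ht1 : t < 1 := by rw [ht, div_lt_one hpos]; linarith
  have htM : t * ∑ i ∈ M, b' i = r' - ∑ i ∈ K, b' i := div_mul_cancel₀ _ hpos.ne'
  refine ⟨fun i => if u i = b i then b' i else if u i = 0 then 0 else t * b' i, fun i => ?_, ?_,
    fun i => ?_⟩
  · have := hb' i
    dsimp only
    split_ifs
    · exact ⟨this.le, le_rfl⟩
    · exact ⟨le_rfl, this.le⟩
    · exact ⟨by positivity, by nlinarith⟩
  · have : ∀ i, (if u i = b i then b' i else if u i = 0 then 0 else t * b' i) =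
        (if u i = b i then b' i else 0) + t * (if u i ≠ b i ∧ u i ≠ 0 then b' i else 0) :=
      fun i => by
        by_cases h1 : u i = b i <;> by_cases h2 : u i = 0 <;> simp [h1, h2]
    rw [Finset.sum_congr rfl fun i _ => this i, Finset.sum_add_distrib, ← Finset.mul_sum,
      ← Finset.sum_filter, ← Finset.sum_filter, htM]
    ring
  · have h0 := hb i
    have h1 := hb' i
    by_cases h2 : u i = b i
    · simp [h2, h0.ne', h1.ne']
    by_cases h3 : u i = 0
    · simp [h3, h0.ne, h1.ne]
    · have h4 : t * b' i ≠ b' i := by nlinarith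
      simp [h2, h3, h1.ne', ht0.ne', h4]

section Split

variable {E : Type*} [AddCommGroup E] [Module ℝ E] [TopologicalSpace E] {k j : ℕ}

/-- The inequalities `0 ≤ ψ i ≤ 1` and `0 ≤ φ i ≤ b' i`, indexed by the coordinates and the ends of
the intervals. -/
def modelIneq (b' : Fin j → ℝ) (φ : Fin j → E → ℝ) (ψ : Fin k → E → ℝ) (d : Fin (k + j) × Bool) :
    E → ℝ :=
  Fin.addCases (motive := fun _ => E → ℝ)
    (fun i z => if d.2 then ψ i z else 1 - ψ i z)
    (fun i z => if d.2 then φ i z else b' i - φ i z) d.1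

/-- If, whatever the values of the first `k` coordinates, the remaining `j` coordinates range over
a slice with the same light sets as the model slice `(b', r')`, then the slice is combinatorially
the product of the model slice and a `k`-cube. -/
theorem combIso_boxSlice_of_split {β : Fin (k + j) → ℝ} {a : ℝ} (hβ : ∀ i, 0 < β i)
    {b' : Fin j → ℝ} {r' : ℝ} (hb' : ∀ i, 0 < b' i)
    (h : ∀ K : Finset (Fin j),
      (2 * ∑ i ∈ K, β (Fin.natAdd k i) < ∑ i, β i - a - 2 * ∑ i : Fin k, β (Fin.castAdd j i) ∧
        ∑ i ∈ K, b' i < r') ∨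
      (∑ i, β i - a < 2 * ∑ i ∈ K, β (Fin.natAdd k i) ∧ r' < ∑ i ∈ K, b' i))
    {φ : Fin j → E → ℝ} {ψ : Fin k → E → ℝ} (hφ : ∀ i, IsAffineFun (φ i))
    (hψ : ∀ i, IsAffineFun (ψ i)) (hsum : ∀ z, ∑ i, φ i z = r')
    (hsurj : ∀ u : Fin j → ℝ, ∑ i, u i = r' → ∀ x : Fin k → ℝ,
      ∃ z, (∀ i, φ i z = u i) ∧ ∀ i, ψ i z = x i) {Q : Set E}
    (hQ : ∀ z, z ∈ Q ↔ (∀ i, 0 ≤ φ i z ∧ φ i z ≤ b' i) ∧ ∀ i, 0 ≤ ψ i z ∧ ψ i z ≤ 1) :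
    CombIso (boxSlice β a) Q := by
  have hQ' : Q = polyhedron Set.univ (modelIneq b' φ ψ) := by
    ext z
    rw [hQ]
    simp only [polyhedron, Set.mem_univ, true_and, Set.mem_ofPred_eq, Prod.forall,
      Fin.forall_fin_add, modelIneq, Fin.addCases_left, Fin.addCases_right, Bool.forall_bool,
      if_true, Bool.false_eq_true, if_false, sub_nonneg]
    exact ⟨fun h => ⟨fun i => (h.2 i).symm, fun i => (h.1 i).symm⟩,
      fun h => ⟨fun i => (h.2 i).symm, fun i => (h.1 i).symm⟩⟩
  have haff : ∀ d, IsAffineFun (modelIneq b' φ ψ d) := by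
    rintro ⟨i, b⟩
    refine Fin.addCases (fun i => ?_) (fun i => ?_) i <;> cases b <;>
      simp only [modelIneq, Fin.addCases_left, Fin.addCases_right, if_true, Bool.false_eq_true,
        if_false]
    · exact (IsAffineFun.const _).sub (hψ i)
    · exact hψ i
    · exact (IsAffineFun.const _).sub (hφ i)
    · exact hφ i
  -- The first `k` coordinates lower the sum left for the others by at most their total; `h` leaves
  -- enough room for this not to change which sets are light.
  have hbnd : ∀ y : Fin k → ℝ, (∀ i, 0 ≤ y i ∧ y i ≤ β (Fin.castAdd j i)) →
      ∀ K : Finset (Fin j),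
        (∑ i ∈ K, β (Fin.natAdd k i) < (∑ i, β i - a) / 2 - ∑ i, y i ∧ ∑ i ∈ K, b' i < r') ∨
        ((∑ i, β i - a) / 2 - ∑ i, y i < ∑ i ∈ K, β (Fin.natAdd k i) ∧ r' < ∑ i ∈ K, b' i) := by
    intro y hy K
    have h1 : 0 ≤ ∑ i, y i := Finset.sum_nonneg fun i _ => (hy i).1
    have h2 : ∑ i, y i ≤ ∑ i, β (Fin.castAdd j i) := Finset.sum_le_sum fun i _ => (hy i).2
    exact (h K).imp (fun h => ⟨by linarith [h.1], h.2⟩) fun h => ⟨by linarith [h.1], h.2⟩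
  rw [hQ']
  refine combIso_polyhedron (isFlat_sum_eq a) isAffineFun_slack isFlat_univ haff ?_ ?_
  · intro w hw
    obtain ⟨hws, hwb⟩ := mem_boxSlice.1 hw
    -- The substitution (β - w) / 2 carries the box to ∏ [0, β i] and the sum to (∑ β - a) / 2. It
    -- exchanges ends: `true` now corresponds to the value 0.
    have hyb : ∀ i, 0 ≤ (β i - w i) / 2 ∧ (β i - w i) / 2 ≤ β i := fun i => by
      constructor <;> linarith [(hwb i).1, (hwb i).2]
    have hys : ∑ i : Fin k, (β (Fin.castAdd j i) - w (Fin.castAdd j i)) / 2 +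
        ∑ i : Fin j, (β (Fin.natAdd k i) - w (Fin.natAdd k i)) / 2 = (∑ i, β i - a) / 2 := by
      rw [← Fin.sum_univ_add fun i => (β i - w i) / 2, ← Finset.sum_div, Finset.sum_sub_distrib,
        hws]
    obtain ⟨u, hub, hus, hu⟩ := exists_same_pattern (b := fun i => β (Fin.natAdd k i))
      (r := (∑ i, β i - a) / 2 - ∑ i : Fin k, (β (Fin.castAdd j i) - w (Fin.castAdd j i)) / 2)
      (fun i => hβ _) hb' (hbnd _ fun i => hyb _)
      (u := fun i => (β (Fin.natAdd k i) - w (Fin.natAdd k i)) / 2) (fun i => hyb _)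
      (by linarith)
    obtain ⟨z, hzφ, hzψ⟩ := hsurj u hus fun i =>
      (β (Fin.castAdd j i) - w (Fin.castAdd j i)) / 2 / β (Fin.castAdd j i)
    refine ⟨z, ?_, ?_⟩
    · rw [← hQ', hQ]
      refine ⟨fun i => by rw [hzφ]; exact hub i, fun i => ?_⟩
      rw [hzψ, div_le_one (hβ _)]
      exact ⟨div_nonneg (hyb _).1 (hβ _).le, (hyb _).2⟩
    · rintro ⟨i, b⟩
      refine Fin.addCases (fun i => ?_) (fun i => ?_) i <;> cases b <;>
        simp only [modelIneq, Fin.addCases_left, Fin.addCases_right, if_true, Bool.false_eq_true,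
          if_false, slack_true, slack_false, hzφ, hzψ]
      · have := hβ (Fin.castAdd j i)
        rw [sub_eq_zero, eq_div_iff this.ne']
        constructor <;> intro h <;> linarith
      · have := hβ (Fin.castAdd j i)
        rw [div_eq_zero_iff, or_iff_left this.ne']
        constructor <;> intro h <;> linarith
      · rw [sub_eq_zero, eq_comm (a := b' i), ← (hu i).2]
        constructor <;> intro h <;> linarith
      · rw [← (hu i).1]
        constructor <;> intro h <;> linarith
  · intro z hz
    rw [← hQ', hQ] at hz
    obtain ⟨hzφ, hzψ⟩ := hz
    have hyb : ∀ i, 0 ≤ β (Fin.castAdd j i) * ψ i z ∧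
        β (Fin.castAdd j i) * ψ i z ≤ β (Fin.castAdd j i) := fun i =>
      ⟨mul_nonneg (hβ _).le (hzψ i).1, mul_le_of_le_one_right (hβ _).le (hzψ i).2⟩
    obtain ⟨u, hub, hus, hu⟩ := exists_same_pattern (b' := fun i => β (Fin.natAdd k i))
      (r' := (∑ i, β i - a) / 2 - ∑ i : Fin k, β (Fin.castAdd j i) * ψ i z) hb' (fun i => hβ _)
      (fun K => (hbnd _ hyb K).imp And.symm And.symm) hzφ (hsum z)
    let y : Fin (k + j) → ℝ :=
      Fin.addCases (fun i => β (Fin.castAdd j i) * ψ i z) u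
    have hyl : ∀ i, y (Fin.castAdd j i) = β (Fin.castAdd j i) * ψ i z := fun i => by simp [y]
    have hyr : ∀ i, y (Fin.natAdd k i) = u i := fun i => by simp [y]
    have hy : ∀ i, 0 ≤ y i ∧ y i ≤ β i := Fin.addCases (fun i => by rw [hyl]; exact hyb i)
      fun i => by rw [hyr]; exact hub i
    have hysum : ∑ i, y i = (∑ i, β i - a) / 2 := by
      rw [Fin.sum_univ_add]
      simp only [hyl, hyr, hus]
      ring
    refine ⟨fun i => β i - 2 * y i, mem_boxSlice.2 ⟨?_, fun i => ?_⟩, ?_⟩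
    · rw [Finset.sum_sub_distrib, ← Finset.mul_sum, hysum]
      ring
    · constructor <;> linarith [(hy i).1, (hy i).2]
    · rintro ⟨i, b⟩
      refine Fin.addCases (fun i => ?_) (fun i => ?_) i <;> cases b <;>
        simp only [modelIneq, Fin.addCases_left, Fin.addCases_right, if_true, Bool.false_eq_true,
          if_false, slack_true, slack_false, hyl, hyr]
      · have := hβ (Fin.castAdd j i)
        constructor
        · intro h
          have h1 : β (Fin.castAdd j i) * (1 - ψ i z) = 0 := by linarith
          exact (mul_eq_zero.1 h1).resolve_left this.ne'
        · intro h
          have h1 : β (Fin.castAdd j i) * (1 - ψ i z) = 0 := by rw [h, mul_zero]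
          linarith
      · have := hβ (Fin.castAdd j i)
        constructor
        · intro h
          have h1 : β (Fin.castAdd j i) * ψ i z = 0 := by linarith
          exact (mul_eq_zero.1 h1).resolve_left this.ne'
        · intro h
          rw [h]
          ring
      · rw [sub_eq_zero (a := b' i), eq_comm (a := b' i), (hu i).2]
        constructor <;> intro h <;> linarith
      · rw [(hu i).1]
        constructor <;> intro h <;> linarith

end Split

/-! #### The model polygons -/

/-- The square `[0, 2]²` cut by the line `x + y = 3`, and by the line `x + y = 3 - c`. -/
def cutSquare (c : ℝ) : Set (ℝ × ℝ) :=
  {z | (0 ≤ z.1 ∧ z.1 ≤ 2) ∧ (0 ≤ z.2 ∧ z.2 ≤ 2) ∧ 0 ≤ 3 - z.1 - z.2 ∧ 3 - z.1 - z.2 ≤ c}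

/-- The six inequalities defining `cutSquare c`. -/
def cutSquareIneq (c : ℝ) : Fin 6 → ℝ × ℝ → ℝ :=
  ![fun z => z.1, fun z => 2 - z.1, fun z => z.2, fun z => 2 - z.2, fun z => 3 - z.1 - z.2,
    fun z => c - (3 - z.1 - z.2)]

theorem isAffineFun_fst : IsAffineFun fun z : ℝ × ℝ => z.1 :=
  IsAffineFun.of_dual (ContinuousLinearMap.fst ℝ ℝ ℝ)

theorem isAffineFun_snd : IsAffineFun fun z : ℝ × ℝ => z.2 :=
  IsAffineFun.of_dual (ContinuousLinearMap.snd ℝ ℝ ℝ)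

theorem isAffineFun_cutSquareIneq (c : ℝ) (i : Fin 6) : IsAffineFun (cutSquareIneq c i) := by
  have h1 := isAffineFun_fst
  have h2 := isAffineFun_snd
  have h3 := ((IsAffineFun.const 3).sub h1).sub h2
  fin_cases i
  · exact h1
  · exact (IsAffineFun.const 2).sub h1
  · exact h2
  · exact (IsAffineFun.const 2).sub h2
  · exact h3
  · exact (IsAffineFun.const c).sub h3

theorem cutSquare_eq (c : ℝ) : cutSquare c = polyhedron Set.univ (cutSquareIneq c) := by
  ext z
  simp [cutSquare, polyhedron, cutSquareIneq, Fin.forall_fin_succ]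
  tauto

theorem isPolytope_cutSquare (c : ℝ) : IsPolytope (cutSquare c) := by
  have hcl : IsClosed (cutSquare c) := by
    have : cutSquare c = ⋂ i, {z | 0 ≤ cutSquareIneq c i z} := by
      rw [cutSquare_eq]
      ext z
      simp [polyhedron]
    rw [this]
    exact isClosed_iInter fun i =>
      isClosed_le continuous_const (isAffineFun_cutSquareIneq c i).continuous
  have hc : IsCompact (cutSquare c) :=
    (isCompact_Icc.prod isCompact_Icc).of_isClosed_subset (s := Set.Icc 0 2 ×ˢ Set.Icc 0 2) hcl
      fun z hz => ⟨hz.1, hz.2.1⟩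
  rw [cutSquare_eq] at hc ⊢
  exact isPolytope_polyhedron isFlat_univ (isAffineFun_cutSquareIneq c) hc

theorem dimension_cutSquare {c : ℝ} (hc : 1 ≤ c) : dimension (cutSquare c) = 2 := by
  have h11 : ((1, 1) : ℝ × ℝ) ∈ cutSquare c := by simp [cutSquare]; norm_num; linarith
  have h21 : ((2, 1) : ℝ × ℝ) ∈ cutSquare c := by simp [cutSquare]; norm_num; linarith
  have h12 : ((1, 2) : ℝ × ℝ) ∈ cutSquare c := by simp [cutSquare]; norm_num; linarith
  have h1 := vsub_mem_vectorSpan ℝ h21 h11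
  have h2 := vsub_mem_vectorSpan ℝ h12 h11
  have htop : vectorSpan ℝ (cutSquare c) = ⊤ := by
    refine eq_top_iff.2 fun z _ => ?_
    have := Submodule.add_mem _ (Submodule.smul_mem _ z.1 h1) (Submodule.smul_mem _ z.2 h2)
    convert this using 1
    ext <;> simp <;> ring
  rw [dimension, htop, finrank_top]
  simp

theorem mem_vertices_polyhedron_iff {E : Type*} [AddCommGroup E] [Module ℝ E] [TopologicalSpace E]
    {κ : Type*} [Finite κ] {A : Set E} {f : κ → E → ℝ} (hA : IsFlat A)
    (hf : ∀ i, IsAffineFun (f i)) {v : E} :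
    v ∈ vertices (polyhedron A f) ↔
      v ∈ polyhedron A f ∧ ∀ x ∈ polyhedron A f, (∀ i, f i v = 0 → f i x = 0) → x = v := by
  constructor
  · intro hv
    have hvP : v ∈ polyhedron A f := IsExposed.subset hv rfl
    exact ⟨hvP, fun x hx h => exposed_subset_activeFace hA hf hv rfl ⟨hx, h⟩⟩
  · rintro ⟨hv, h⟩
    have : {v} = activeFace A f v := by
      ext x
      refine ⟨?_, fun hx => h x hx.1 hx.2⟩
      rintro rfl
      exact mem_activeFace_self hv
    show IsExposed ℝ _ {v}
    rw [this]
    exact isExposed_activeFace hf hv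

theorem mem_vertices_cutSquare_iff {c : ℝ} {v : ℝ × ℝ} :
    v ∈ vertices (cutSquare c) ↔ v ∈ cutSquare c ∧ ∀ x ∈ cutSquare c,
      (v.1 = 0 → x.1 = 0) → (v.1 = 2 → x.1 = 2) → (v.2 = 0 → x.2 = 0) → (v.2 = 2 → x.2 = 2) →
      (3 - v.1 - v.2 = 0 → 3 - x.1 - x.2 = 0) → (3 - v.1 - v.2 = c → 3 - x.1 - x.2 = c) →
      x = v := by
  rw [cutSquare_eq, mem_vertices_polyhedron_iff isFlat_univ (isAffineFun_cutSquareIneq c)]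
  refine and_congr_right fun _ => forall₂_congr fun x _ => ?_
  have e : ∀ s t : ℝ, s - t = 0 ↔ t = s := fun s t => by rw [sub_eq_zero, eq_comm]
  simp only [cutSquareIneq, Fin.forall_fin_succ, IsEmpty.forall_iff, and_true, Matrix.cons_val_zero,
    Matrix.cons_val_succ, e 2, e c, and_imp]

/-- A vertex of the model polygon lies on two of its three pairs of parallel lines. -/
theorem two_tight_of_mem_vertices {c : ℝ} {v : ℝ × ℝ} (hv : v ∈ vertices (cutSquare c)) :
    ((v.1 = 0 ∨ v.1 = 2) ∧ (v.2 = 0 ∨ v.2 = 2)) ∨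
    ((v.1 = 0 ∨ v.1 = 2) ∧ (3 - v.1 - v.2 = 0 ∨ 3 - v.1 - v.2 = c)) ∨
    ((v.2 = 0 ∨ v.2 = 2) ∧ (3 - v.1 - v.2 = 0 ∨ 3 - v.1 - v.2 = c)) := by
  obtain ⟨⟨⟨h1, h2⟩, ⟨h3, h4⟩, h5, h6⟩, hmin⟩ := mem_vertices_cutSquare_iff.1 hv
  obtain ⟨x, y⟩ := v
  dsimp only at *
  have pos : ∀ {s t : ℝ}, s ≤ t → s ≠ t → 0 < t - s := fun h h' =>
    sub_pos.2 (lt_of_le_of_ne h h')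
  by_contra hcon
  -- If two of the three pairs of lines are missed, the point can be moved parallel to the third
  -- pair, along (1, -1), (1, 0) or (0, 1), without losing any active constraint; so it is not a
  -- vertex.
  have hcon' : (¬ (x = 0 ∨ x = 2) ∧ ¬ (y = 0 ∨ y = 2)) ∨
      (¬ (x = 0 ∨ x = 2) ∧ ¬ (3 - x - y = 0 ∨ 3 - x - y = c)) ∨
      (¬ (y = 0 ∨ y = 2) ∧ ¬ (3 - x - y = 0 ∨ 3 - x - y = c)) := by tauto
  simp only [not_or] at hcon'
  rcases hcon' with ⟨hx, hy⟩ | ⟨hx, hw⟩ | ⟨hy, hw⟩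
  · have hε := lt_min (pos h2 hx.2) (pos h3 (Ne.symm hy.1))
    have m1 := min_le_left (2 - x) (y - 0)
    have m2 := min_le_right (2 - x) (y - 0)
    set ε := min (2 - x) (y - 0)
    have := hmin (x + ε / 2, y - ε / 2)
      ⟨⟨by dsimp; linarith, by dsimp; linarith⟩, ⟨by dsimp; linarith, by dsimp; linarith⟩,
        by dsimp; linarith, by dsimp; linarith⟩
      (fun h => absurd h hx.1) (fun h => absurd h hx.2) (fun h => absurd h hy.1)
      (fun h => absurd h hy.2) (fun h => by dsimp; linarith) (fun h => by dsimp; linarith)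
    linarith [congrArg Prod.fst this]
  · have hε := lt_min (pos h2 hx.2) (pos h5 (Ne.symm hw.1))
    have m1 := min_le_left (2 - x) (3 - x - y - 0)
    have m2 := min_le_right (2 - x) (3 - x - y - 0)
    set ε := min (2 - x) (3 - x - y - 0)
    have := hmin (x + ε / 2, y)
      ⟨⟨by dsimp; linarith, by dsimp; linarith⟩, ⟨h3, h4⟩, by dsimp; linarith, by dsimp; linarith⟩
      (fun h => absurd h hx.1) (fun h => absurd h hx.2) id id
      (fun h => absurd h hw.1) (fun h => absurd h hw.2)
    linarith [congrArg Prod.fst this]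
  · have hε := lt_min (pos h4 hy.2) (pos h5 (Ne.symm hw.1))
    have m1 := min_le_left (2 - y) (3 - x - y - 0)
    have m2 := min_le_right (2 - y) (3 - x - y - 0)
    set ε := min (2 - y) (3 - x - y - 0)
    have := hmin (x, y + ε / 2)
      ⟨⟨h1, h2⟩, ⟨by dsimp; linarith, by dsimp; linarith⟩, by dsimp; linarith, by dsimp; linarith⟩
      id id (fun h => absurd h hy.1) (fun h => absurd h hy.2)
      (fun h => absurd h hw.1) (fun h => absurd h hw.2)
    linarith [congrArg Prod.snd this]

theorem vertices_cutSquare_four :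
    vertices (cutSquare 4) = {(0, 0), (2, 0), (0, 2), (2, 1), (1, 2)} := by
  ext ⟨x, y⟩
  simp only [Set.mem_insert_iff, Set.mem_singleton_iff, Prod.mk.injEq]
  constructor
  · intro hv
    obtain ⟨⟨⟨h1, h2⟩, ⟨h3, h4⟩, h5, h6⟩, -⟩ := mem_vertices_cutSquare_iff.1 hv
    have h := two_tight_of_mem_vertices hv
    dsimp only at *
    grind
  · intro h
    rw [mem_vertices_cutSquare_iff]
    rcases h with ⟨rfl, rfl⟩ | ⟨rfl, rfl⟩ | ⟨rfl, rfl⟩ | ⟨rfl, rfl⟩ | ⟨rfl, rfl⟩ <;>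
    · refine ⟨by simp [cutSquare]; norm_num, ?_⟩
      rintro ⟨x, y⟩ ⟨⟨h1, h2⟩, ⟨h3, h4⟩, h5, h6⟩
      norm_num at *
      grind

theorem vertices_cutSquare_two :
    vertices (cutSquare 2) = {(1, 0), (0, 1), (2, 0), (0, 2), (2, 1), (1, 2)} := by
  ext ⟨x, y⟩
  simp only [Set.mem_insert_iff, Set.mem_singleton_iff, Prod.mk.injEq]
  constructor
  · intro hv
    obtain ⟨⟨⟨h1, h2⟩, ⟨h3, h4⟩, h5, h6⟩, -⟩ := mem_vertices_cutSquare_iff.1 hv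
    have h := two_tight_of_mem_vertices hv
    dsimp only at *
    grind
  · intro h
    rw [mem_vertices_cutSquare_iff]
    rcases h with ⟨rfl, rfl⟩ | ⟨rfl, rfl⟩ | ⟨rfl, rfl⟩ | ⟨rfl, rfl⟩ | ⟨rfl, rfl⟩ | ⟨rfl, rfl⟩ <;>
    · refine ⟨by simp [cutSquare]; norm_num, ?_⟩
      rintro ⟨x, y⟩ ⟨⟨h1, h2⟩, ⟨h3, h4⟩, h5, h6⟩
      norm_num at *
      grind

theorem isPolygon_cutSquare_four : IsPolygon 5 (cutSquare 4) := by
  refine ⟨isPolytope_cutSquare 4, dimension_cutSquare (by norm_num), ?_⟩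
  rw [vertices_cutSquare_four]
  repeat rw [Set.encard_insert_of_notMem (by simp)]
  rw [Set.encard_singleton]
  norm_num

theorem isPolygon_cutSquare_two : IsPolygon 6 (cutSquare 2) := by
  refine ⟨isPolytope_cutSquare 2, dimension_cutSquare (by norm_num), ?_⟩
  rw [vertices_cutSquare_two]
  repeat rw [Set.encard_insert_of_notMem (by simp)]
  rw [Set.encard_singleton]
  norm_num

/-! #### The three combinatorial types -/

theorem combIso_cube_of_isCubeVector {n : ℕ} {β : Fin n → ℝ} {a : ℝ} (hβ : ∀ i, 0 < β i)
    (hm : Monotone β) (ha : 0 < a) (h : IsCubeVector β a) :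
    CombIso (boxSlice β a) (cube (n - 1)) := by
  obtain ⟨q, r, hq, hr, h1, h2⟩ := h
  -- The index `q`, read as a natural number, is n - 2, the number of coordinates to split off.
  obtain ⟨k, rfl⟩ : ∃ k, n = k + 2 := ⟨q, hq.symm⟩
  have hqr : β q ≤ β r := hm (Fin.le_def.2 (by omega))
  obtain rfl : q = Fin.natAdd k 0 := Fin.ext (by simpa using hq)
  obtain rfl : r = Fin.natAdd k 1 := Fin.ext (by simpa using hr)
  have hsum := Fin.sum_univ_add β
  rw [Fin.sum_univ_two] at hsum
  have hS : 0 ≤ ∑ i : Fin k, β (Fin.castAdd 2 i) := Finset.sum_nonneg fun i _ => (hβ _).le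
  -- In the model with bounds 2, 2 and sum 1 only ∅ is light. It is a segment whose upper bounds are
  -- never attained, and it supplies the last coordinate of the cube.
  refine combIso_boxSlice_of_split (E := Fin (k + 1) → ℝ) (b' := fun _ => 2) (r' := 1) hβ
    (fun _ => by norm_num) (fun K => ?_)
    (φ := ![fun z => z (Fin.last k), fun z => 1 - z (Fin.last k)])
    (ψ := fun i z => z i.castSucc) ?_ (fun i => isAffineFun_apply _) (fun z => ?_)
    (fun u hu x => ⟨Fin.snoc x (u 0), ?_, fun i => by simp⟩) fun z => ?_
  · rw [← Finset.univ_inter K, ← Finset.sum_ite_mem, ← Finset.sum_ite_mem, Fin.sum_univ_two,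
      Fin.sum_univ_two]
    by_cases h0 : (0 : Fin 2) ∈ K <;> by_cases h1 : (1 : Fin 2) ∈ K <;>
      simp only [h0, h1, if_true, if_false]
    · right; constructor <;> linarith
    · right; constructor <;> linarith
    · right; constructor <;> linarith
    · left; constructor <;> linarith
  · rw [Fin.forall_fin_two]
    exact ⟨isAffineFun_apply _, (IsAffineFun.const 1).sub (isAffineFun_apply _)⟩
  · simp [Fin.sum_univ_two]
  · rw [Fin.forall_fin_two]
    rw [Fin.sum_univ_two] at hu
    refine ⟨by simp, ?_⟩
    simp only [Matrix.cons_val_one, Matrix.cons_val_fin_one, Fin.snoc_last]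
    linarith
  · show (∀ i : Fin (k + 1), z i ∈ Set.Icc (0 : ℝ) 1) ↔ _
    rw [Fin.forall_fin_two, Fin.forall_fin_succ']
    simp only [Matrix.cons_val_zero, Matrix.cons_val_one, Matrix.cons_val_fin_one, Set.mem_Icc]
    constructor
    · rintro ⟨hz, h1, h2⟩
      exact ⟨⟨⟨h1, by linarith⟩, by linarith, by linarith⟩, hz⟩
    · rintro ⟨⟨⟨h1, -⟩, h2, -⟩, hz⟩
      exact ⟨hz, h1, by linarith⟩

theorem combIso_cutSquare_prod {k : ℕ} {β : Fin (k + 3) → ℝ} {a c : ℝ} (hβ : ∀ i, 0 < β i)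
    (hc : 0 < c)
    (h : ∀ K : Finset (Fin 3),
      (2 * ∑ i ∈ K, β (Fin.natAdd k i) < ∑ i, β i - a - 2 * ∑ i : Fin k, β (Fin.castAdd 3 i) ∧
        ∑ i ∈ K, ![2, 2, c] i < 3) ∨
      (∑ i, β i - a < 2 * ∑ i ∈ K, β (Fin.natAdd k i) ∧ 3 < ∑ i ∈ K, ![2, 2, c] i)) :
    CombIso (boxSlice β a) (cutSquare c ×ˢ cube k) := by
  have hfst : IsAffineFun fun z : (ℝ × ℝ) × (Fin k → ℝ) => z.1.1 :=
    IsAffineFun.of_dual ((ContinuousLinearMap.fst ℝ ℝ ℝ).comp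
      (ContinuousLinearMap.fst ℝ (ℝ × ℝ) (Fin k → ℝ)))
  have hsnd : IsAffineFun fun z : (ℝ × ℝ) × (Fin k → ℝ) => z.1.2 :=
    IsAffineFun.of_dual ((ContinuousLinearMap.snd ℝ ℝ ℝ).comp
      (ContinuousLinearMap.fst ℝ (ℝ × ℝ) (Fin k → ℝ)))
  have hcube : ∀ i, IsAffineFun fun z : (ℝ × ℝ) × (Fin k → ℝ) => z.2 i := fun i =>
    IsAffineFun.of_dual ((ContinuousLinearMap.proj (R := ℝ) (φ := fun _ : Fin k => ℝ) i).comp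
      (ContinuousLinearMap.snd ℝ (ℝ × ℝ) (Fin k → ℝ)))
  refine combIso_boxSlice_of_split (b' := ![2, 2, c]) hβ ?_ h
    (φ := ![fun z => z.1.1, fun z => z.1.2, fun z => 3 - z.1.1 - z.1.2])
    (ψ := fun i z => z.2 i) ?_ hcube (fun z => ?_)
    (fun u hu x => ⟨((u 0, u 1), x), ?_, fun i => rfl⟩) fun z => ?_
  · simp [Fin.forall_fin_succ, hc]
  · intro i
    fin_cases i
    · exact hfst
    · exact hsnd
    · exact ((IsAffineFun.const 3).sub hfst).sub hsnd
  · simp [Fin.sum_univ_three]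
  · intro i
    rw [Fin.sum_univ_three] at hu
    fin_cases i
    · rfl
    · rfl
    · show 3 - u 0 - u 1 = u 2
      linarith
  · show (z.1 ∈ cutSquare c ∧ ∀ i, 0 ≤ z.2 i ∧ z.2 i ≤ 1) ↔ _
    simp [cutSquare, Fin.forall_fin_succ]

theorem sum_eq_ite_fin_three (f : Fin 3 → ℝ) (K : Finset (Fin 3)) :
    ∑ i ∈ K, f i = (if 0 ∈ K then f 0 else 0) + (if 1 ∈ K then f 1 else 0) +
      if 2 ∈ K then f 2 else 0 := by
  rw [← Fin.sum_univ_three fun i => if i ∈ K then f i else 0, Finset.sum_ite_mem, Finset.univ_inter]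

/-- Among subsets of `{p, q, r}` the light ones for the lower threshold are ∅, `{p}` and `{q}`, as
for bounds 2, 2, 4 and sum 3; the bound 4 is never attained. -/
theorem combIso_of_isPentagonVector {n : ℕ} {β : Fin n → ℝ} {a : ℝ} (hβ : ∀ i, 0 < β i)
    (hm : Monotone β) (h : IsPentagonVector β a) :
    CombIso (boxSlice β a) (cutSquare 4 ×ˢ cube (n - 3)) := by
  obtain ⟨p, q, r, hp, hq, hr, h1, h2, h3⟩ := h
  obtain ⟨k, rfl⟩ : ∃ k, n = k + 3 := ⟨p, hp.symm⟩
  have hpq : β p ≤ β q := hm (Fin.le_def.2 (by omega))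
  have hp0 := hβ p
  obtain rfl : p = Fin.natAdd k 0 := Fin.ext (by simpa using hp)
  obtain rfl : q = Fin.natAdd k 1 := Fin.ext (by simpa using hq)
  obtain rfl : r = Fin.natAdd k 2 := Fin.ext (by simpa using hr)
  have hsum := Fin.sum_univ_add β
  rw [Fin.sum_univ_three] at hsum
  have hS : 0 ≤ ∑ i : Fin k, β (Fin.castAdd 3 i) := Finset.sum_nonneg fun i _ => (hβ _).le
  refine combIso_cutSquare_prod hβ (by norm_num) fun K => ?_
  rw [sum_eq_ite_fin_three, sum_eq_ite_fin_three]
  by_cases k0 : (0 : Fin 3) ∈ K <;> by_cases k1 : (1 : Fin 3) ∈ K <;>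
    by_cases k2 : (2 : Fin 3) ∈ K <;>
    simp only [k0, k1, k2, if_true, if_false, Matrix.cons_val] <;>
    first
    | (left; constructor <;> linarith)
    | (right; constructor <;> linarith)

/-- Among subsets of `{p, q, r}` the light ones for the lower threshold are ∅ and the singletons, as
for bounds 2, 2, 2 and sum 3. -/
theorem combIso_of_isHexagonVector {n : ℕ} {β : Fin n → ℝ} {a : ℝ} (hβ : ∀ i, 0 < β i)
    (hm : Monotone β) (ha : 0 < a) (h : IsHexagonVector β a) :
    CombIso (boxSlice β a) (cutSquare 2 ×ˢ cube (n - 3)) := by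
  obtain ⟨p, q, r, hp, hq, hr, h1⟩ := h
  obtain ⟨k, rfl⟩ : ∃ k, n = k + 3 := ⟨p, hp.symm⟩
  have hpq : β p ≤ β q := hm (Fin.le_def.2 (by omega))
  have hqr : β q ≤ β r := hm (Fin.le_def.2 (by omega))
  have hp0 := hβ p
  obtain rfl : p = Fin.natAdd k 0 := Fin.ext (by simpa using hp)
  obtain rfl : q = Fin.natAdd k 1 := Fin.ext (by simpa using hq)
  obtain rfl : r = Fin.natAdd k 2 := Fin.ext (by simpa using hr)
  have hsum := Fin.sum_univ_add β
  rw [Fin.sum_univ_three] at hsum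
  have hS : 0 ≤ ∑ i : Fin k, β (Fin.castAdd 3 i) := Finset.sum_nonneg fun i _ => (hβ _).le
  refine combIso_cutSquare_prod hβ (by norm_num) fun K => ?_
  rw [sum_eq_ite_fin_three, sum_eq_ite_fin_three]
  by_cases k0 : (0 : Fin 3) ∈ K <;> by_cases k1 : (1 : Fin 3) ∈ K <;>
    by_cases k2 : (2 : Fin 3) ∈ K <;>
    simp only [k0, k1, k2, if_true, if_false, Matrix.cons_val] <;>
    first
    | (left; constructor <;> linarith)
    | (right; constructor <;> linarith)

theorem momentPolytope_eq_boxSlice {n : ℕ} (α : Fin (n + 1) → ℝ) :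
    momentPolytope α = boxSlice (fun i : Fin n => α i.castSucc) (α (Fin.last n)) := by
  ext w
  rw [mem_boxSlice]
  exact and_comm

end ChainPolytope

/-! ### Classification of the flag moment polytopes -/

theorem theorem5p2 (n : ℕ) (α : Fin (n + 1) → ℝ)
    (hα : ChainPolytope.IsChainVector α)
    (hT : ChainPolytope.shortCode α ≠ {ChainPolytope.geneTorus n}) :
    (ChainPolytope.IsFlagtope (ChainPolytope.momentPolytope α) ↔
      ChainPolytope.shortCode α = {ChainPolytope.geneCube n} ∨
      ChainPolytope.shortCode α = {ChainPolytope.genePentagon n} ∨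
      ChainPolytope.shortCode α = {ChainPolytope.geneHexagon n}) ∧
    (ChainPolytope.shortCode α = {ChainPolytope.geneCube n} →
      ChainPolytope.CombIso (ChainPolytope.momentPolytope α) (ChainPolytope.cube (n - 1))) ∧
    (ChainPolytope.shortCode α = {ChainPolytope.genePentagon n} →
      ∃ Q : Set (ℝ × ℝ), ChainPolytope.IsPolygon 5 Q ∧
        ChainPolytope.CombIso (ChainPolytope.momentPolytope α)
          (Q ×ˢ ChainPolytope.cube (n - 3))) ∧
    (ChainPolytope.shortCode α = {ChainPolytope.geneHexagon n} →
      ∃ Q : Set (ℝ × ℝ), ChainPolytope.IsPolygon 6 Q ∧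
        ChainPolytope.CombIso (ChainPolytope.momentPolytope α)
          (Q ×ˢ ChainPolytope.cube (n - 3))) := by
  have hR := hα.isReduced
  have hnt := ChainPolytope.two_mul_lt_of_shortCode_ne hα hT
  rw [ChainPolytope.momentPolytope_eq_boxSlice, ChainPolytope.shortCode_eq_geneCube_iff hα hnt,
    ChainPolytope.shortCode_eq_genePentagon_iff hα hnt,
    ChainPolytope.shortCode_eq_geneHexagon_iff hα hnt]
  refine ⟨?_, ChainPolytope.combIso_cube_of_isCubeVector hR.pos hR.mono hR.pos_last,
    fun h => ⟨_, ChainPolytope.isPolygon_cutSquare_four,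
      ChainPolytope.combIso_of_isPentagonVector hR.pos hR.mono h⟩,
    fun h => ⟨_, ChainPolytope.isPolygon_cutSquare_two,
      ChainPolytope.combIso_of_isHexagonVector hR.pos hR.mono hR.pos_last h⟩⟩
  rw [ChainPolytope.isFlagtope_boxSlice_iff hR.pos hR.generic (sub_pos.2 hR.last_lt)
    (add_pos (hR.pos_last.trans hR.last_lt) hR.pos_last)]
  exact ⟨fun h => ChainPolytope.cubeOrPentagonOrHexagon_of_light hR.mono hR.generic hR.last_lt hnt
      h.1 h.2,
    ChainPolytope.light_of_cubeOrPentagonOrHexagon hR.pos hR.mono hR.pos_last⟩
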